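/- For real $\mu,\nu$ and $x>0$ let $$\tilde t_{\mu,\nu}(x)=\sum_{k=0}^\infty\frac{(x/2)^{\mu+2k+1}}{\Gamma\big(k+\frac{\mu-\nu+3}{2}\big)\Gamma\big(k+\frac{\mu+\nu+3}{2}\big)}$$ be the (normalised) modified Lommel function of the first kind, with the convention $1/\Gamma=0$ at the poles of $\Gamma$. Let $\gamma(a,x)=\int_0^x e^{-u}u^{a-1}\,du$ be the lower incomplete gamma function and $$B_{\mu,\nu,\beta}(x)=\frac{\beta^{-\mu-\nu-1}\,\gamma(\mu+\nu+1,\beta x)}{2^{\mu}\,\Gamma\big(\frac{\mu-\nu+1}{2}\big)\Gamma\big(\frac{\mu+\nu+3}{2}\big)}.$$ **Theorem.** Let $0<\beta<1$. (i) If $\mu>-1$ and $-\mu-1<\nu\le 0$, then for all $x>0$ $$\int_0^x e^{-\beta u}u^\nu\tilde t_{\mu,\nu}(u)\,du>\frac{1}{1-\beta}\Big\{e^{-\beta x}x^\nu\tilde t_{\mu,\nu}(x)-B_{\mu,\nu,\beta}(x)\Big\}.$$ (ii) If $\mu>\frac12$ and $\frac32\le\nu<\mu+1$, then for all $x>0$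 $$\int_0^x e^{-\beta u}u^\nu\tilde t_{\mu,\nu}(u)\,du>\frac{1}{1-\beta}\Big\{\Big(1-\frac{4\nu^2}{(2\nu-1)(1-\beta)}\frac1x\Big)e^{-\beta x}x^\nu\tilde t_{\mu,\nu}(x)-B_{\mu,\nu,\beta}(x)\Big\}.$$ (iii) If $\mu>-\frac12$ and $\frac12<\nu<\mu+1$, then for all $x>0$ $$\int_0^x e^{-\beta u}u^\nu\tilde t_{\mu,\nu}(u)\,du>\frac{1}{1-\beta}\Big\{\Big(1-\frac{2\nu\big(\mu+\nu+\frac12(5+\sqrt{17})\big)}{(2\nu-1)(1-\beta)}\frac1x\Big)e^{-\beta x}x^\nu\tilde t_{\mu,\nu}(x)-B_{\mu,\nu,\beta}(x)\Big\}.$$ (iv) If $\mu>-\frac52$ and $-\mu-2<\nu\le\mu+3$, then for all $x>0$ the integral below exists, the series below converges, and $$\int_0^x e^{-\beta u}u^\nu\tilde t_{\mu,\nu}(u)\,du>e^{-\beta x}x^\nu\sum_{k=0}^\infty\beta^k\,\tilde t_{\mu+k+1,\nu+k+1}(x).$$ (The range in (iv) contains the ranges in (i)–(iii).) In each of (i)–(iv),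 for fixed $\mu,\nu,\beta$ in the stated range, the bound is tight as $x\to\infty$: the ratio of the right-hand side to the left-hand side tends to $1$. -/

import Mathlib

open Filter Topology

noncomputable section

/-- The normalised modified Lommel function of the first kind
`t̃_{μ,ν}(x) = ∑ₖ (x/2)^(μ+2k+1) / (Γ(k+(μ-ν+3)/2) Γ(k+(μ+ν+3)/2))`, used for `x > 0`.
At a pole of a Gamma factor the summand is `0`, in accordance with `1/Γ = 0` there. -/
def lommelT (μ ν x : ℝ) : ℝ :=
  ∑' k : ℕ, (x / 2) ^ (μ + 2 * (k : ℝ) + 1) /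
    (Real.Gamma ((k : ℝ) + (μ - ν + 3) / 2) * Real.Gamma ((k : ℝ) + (μ + ν + 3) / 2))

/-- The series defining `lommelT` converges for every `x > 0` and all real parameters. -/
theorem summable_lommelT (μ ν : ℝ) {x : ℝ} (hx : 0 < x) :
    Summable (fun k : ℕ => (x / 2) ^ (μ + 2 * (k : ℝ) + 1) /
      (Real.Gamma ((k : ℝ) + (μ - ν + 3) / 2) * Real.Gamma ((k : ℝ) + (μ + ν + 3) / 2))) := by
  have hx2 : 0 < x / 2 := by positivity
  set p := (μ - ν + 3) / 2 with hp
  set q := (μ + ν + 3) / 2 with hq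
  have hcast : Tendsto (fun k : ℕ => (k : ℝ)) atTop atTop := tendsto_natCast_atTop_atTop
  have hpe : ∀ᶠ k : ℕ in atTop, 0 < (k : ℝ) + p :=
    (tendsto_atTop_add_const_right _ p hcast).eventually_gt_atTop 0
  have hqe : ∀ᶠ k : ℕ in atTop, 0 < (k : ℝ) + q :=
    (tendsto_atTop_add_const_right _ q hcast).eventually_gt_atTop 0
  refine summable_of_ratio_test_tendsto_lt_one (l := 0) one_pos ?_ ?_
  · filter_upwards [hpe, hqe] with k h1 h2
    have := Real.Gamma_pos_of_pos h1
    have := Real.Gamma_pos_of_pos h2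
    positivity
  · have hlim : Tendsto (fun k : ℕ => (x / 2) ^ 2 / (((k : ℝ) + p) * ((k : ℝ) + q)))
        atTop (𝓝 0) :=
      Tendsto.div_atTop tendsto_const_nhds
        ((tendsto_atTop_add_const_right _ p hcast).atTop_mul_atTop₀
          (tendsto_atTop_add_const_right _ q hcast))
    refine hlim.congr' ?_
    filter_upwards [hpe, hqe] with k h1 h2
    have g1 := Real.Gamma_pos_of_pos h1
    have g2 := Real.Gamma_pos_of_pos h2
    have e1 : Real.Gamma (((k + 1 : ℕ) : ℝ) + p) = ((k : ℝ) + p) * Real.Gamma ((k : ℝ) + p) := by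
      rw [← Real.Gamma_add_one h1.ne']; congr 1; push_cast; ring
    have e2 : Real.Gamma (((k + 1 : ℕ) : ℝ) + q) = ((k : ℝ) + q) * Real.Gamma ((k : ℝ) + q) := by
      rw [← Real.Gamma_add_one h2.ne']; congr 1; push_cast; ring
    have e3 : (x / 2) ^ (μ + 2 * ((k + 1 : ℕ) : ℝ) + 1)
        = (x / 2) ^ (μ + 2 * (k : ℝ) + 1) * (x / 2) ^ 2 := by
      rw [← Real.rpow_natCast (x / 2) 2, ← Real.rpow_add hx2]; congr 1; push_cast; ring
    have g3 : 0 < (x / 2) ^ (μ + 2 * (k : ℝ) + 1) := Real.rpow_pos_of_pos hx2 _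
    rw [e1, e2, e3, Real.norm_of_nonneg (by positivity), Real.norm_of_nonneg (by positivity)]
    field_simp

/-- The lower incomplete gamma function `γ(a, x) = ∫₀ˣ e^{-u} u^{a-1} du`. -/
def lowerIncGamma (a x : ℝ) : ℝ :=
  ∫ u in (0 : ℝ)..x, Real.exp (-u) * u ^ (a - 1)

/-- The integral `∫₀ˣ e^{-βu} u^ν t̃_{μ,ν}(u) du`. -/
def lommelIntegral (μ ν β x : ℝ) : ℝ :=
  ∫ u in (0 : ℝ)..x, Real.exp (-(β * u)) * u ^ ν * lommelT μ ν u

/-- The quantity `B_{μ,ν,β}`, which also depends on the point `x`. -/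
def lommelB (μ ν β x : ℝ) : ℝ :=
  β ^ (-μ - ν - 1) * lowerIncGamma (μ + ν + 1) (β * x) /
    ((2 : ℝ) ^ μ * Real.Gamma ((μ - ν + 1) / 2) * Real.Gamma ((μ + ν + 3) / 2))

/-- `L` is a strict lower bound for `F` on `(0, ∞)` that is tight as `x → ∞`: the ratio
of bound to bounded quantity tends to `1`. -/
def IsTightStrictLowerBound (L F : ℝ → ℝ) : Prop :=
  (∀ x : ℝ, 0 < x → L x < F x) ∧ Tendsto (fun x => L x / F x) atTop (𝓝 1)

end

/-! In the parameters `a = (μ-ν+3)/2`, `b = (μ+ν+3)/2`, so `ν = b - a`, the series becomes a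
function G_{a,b} symmetric in `a` and `b`. Termwise differentiation gives ((x/2)^ν G_{a,b})' =
(x/2)^ν G_{a,b-1}. Symmetry, together with splitting off the first summand, turns this into
G_{a,b-1} = G_{a,b+1} + (2ν/x) G_{a,b} + (a power of x).

Write W^s_b = e^{-βx} x^s G_{a,b} and J^s_b for its integral over [0, x]. Integration by parts gives
W^ν_b = J^ν_{b-1} - β J^ν_b. By the recurrence, J^ν_{b-1} = J^ν_{b+1} + 2ν J^{ν-1}_b + B, since B is
the integral of the weighted power. For 0 < a ≤ b an AM-GM comparison of summands gives G_{a,b+1} <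
G_{a,b}, hence W^ν_b < (1-β) J^ν_b + 2ν J^{ν-1}_b + B. Bounds (ii) and (iii) follow by estimating
J^{ν-1}_b through the monotonicity of e^{-x} √x G_{a,b} (`lommelJ_le_mul_lommelW`). For ν ≤ 0,
G_{a,b-1} is compared with G_{a,b} directly, which gives (i).

For (iv), integration by parts at `b+n+1` reads J^ν_{b+n} = W^ν_{b+n+1} + (n+1) J^{ν-1}_{b+n+1} + β
J^ν_{b+n+1}. Iterating and discarding positive terms leaves the series.

Tightness rests on G_{a,b+1}/G_{a,b} → 1 and on G_{a,b} outgrowing every power; both pass to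
integrals by `tendsto_integral_div_integral`. -/

noncomputable section


/-! ### The series in symmetric parameters: derivative and recurrence -/

/-- The summands of the series `lommelG`. -/
def lommelTerm (a b x : ℝ) (k : ℕ) : ℝ :=
  (x / 2) ^ (a + b - 2 + 2 * (k : ℝ)) /
    (Real.Gamma ((k : ℝ) + a) * Real.Gamma ((k : ℝ) + b))

/-- The modified Lommel function in the symmetric parameters
`a = (μ - ν + 3) / 2` and `b = (μ + ν + 3) / 2`. -/
def lommelG (a b x : ℝ) : ℝ := ∑' k : ℕ, lommelTerm a b x k

theorem lommelT_eq_lommelG (μ ν x : ℝ) :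
    lommelT μ ν x = lommelG ((μ - ν + 3) / 2) ((μ + ν + 3) / 2) x := by
  refine tsum_congr fun k => ?_
  rw [lommelTerm]
  congr 2
  ring

theorem lommelTerm_comm (a b x : ℝ) (k : ℕ) : lommelTerm a b x k = lommelTerm b a x k := by
  rw [lommelTerm, lommelTerm, mul_comm (Real.Gamma _), add_comm a b]

theorem lommelG_comm (a b x : ℝ) : lommelG a b x = lommelG b a x :=
  tsum_congr (lommelTerm_comm a b x)

theorem summable_lommelTerm (a b : ℝ) {x : ℝ} (hx : 0 < x) : Summable (lommelTerm a b x) := by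
  refine (summable_lommelT (a + b - 3) (b - a) hx).congr fun k => ?_
  rw [lommelTerm]
  congr 2
  · ring
  · congr 1; ring
  · congr 1; ring

/-- With the value 0 at the poles this holds for every `z`, so summands at poles need no separate
treatment when differentiating. -/
theorem Real.inv_Gamma_sub_one (z : ℝ) :
    (Real.Gamma (z - 1))⁻¹ = (z - 1) * (Real.Gamma z)⁻¹ := by
  by_cases h : z - 1 = 0
  · simp [h, Real.Gamma_zero]
  · have := Real.Gamma_add_one h
    rw [sub_add_cancel] at this
    rw [this, mul_inv, mul_inv_cancel_left₀ h]

theorem lommelTerm_nonneg {a b x : ℝ} (ha : 0 ≤ a) (hb : 0 ≤ b) (hx : 0 < x) (k : ℕ) :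
    0 ≤ lommelTerm a b x k := by
  have h1 : 0 ≤ Real.Gamma (k + a) := Real.Gamma_nonneg_of_nonneg (by positivity)
  have h2 : 0 ≤ Real.Gamma (k + b) := Real.Gamma_nonneg_of_nonneg (by positivity)
  rw [lommelTerm]
  positivity

theorem lommelTerm_pos {a b x : ℝ} {k : ℕ} (ha : 0 < k + a) (hb : 0 < k + b) (hx : 0 < x) :
    0 < lommelTerm a b x k := by
  have h1 := Real.Gamma_pos_of_pos ha
  have h2 := Real.Gamma_pos_of_pos hb
  rw [lommelTerm]
  positivity

theorem lommelG_nonneg {a b x : ℝ} (ha : 0 ≤ a) (hb : 0 ≤ b) (hx : 0 < x) :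
    0 ≤ lommelG a b x :=
  tsum_nonneg (lommelTerm_nonneg ha hb hx)

theorem lommelG_pos {a b x : ℝ} (ha : 0 ≤ a) (hb : 0 ≤ b) (hx : 0 < x) :
    0 < lommelG a b x :=
  -- Index 1 rather than 0: the zeroth summand vanishes when `a = 0` or `b = 0`.
  (summable_lommelTerm a b hx).tsum_pos (lommelTerm_nonneg ha hb hx) 1
    (lommelTerm_pos (by push_cast; linarith) (by push_cast; linarith) hx)

/-- Splitting off the first summand. -/
theorem lommelG_eq_add (a b : ℝ) {x : ℝ} (hx : 0 < x) :
    lommelG a b x = (x / 2) ^ (a + b - 2) / (Real.Gamma a * Real.Gamma b) +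
      lommelG (a + 1) (b + 1) x := by
  rw [lommelG, (summable_lommelTerm a b hx).tsum_eq_zero_add, lommelG]
  congr 1
  · simp [lommelTerm]
  · refine tsum_congr fun k => ?_
    rw [lommelTerm, lommelTerm]
    push_cast
    congr 2
    · ring
    · congr 1; ring
    · congr 1; ring

theorem Real.rpow_le_rpow_add_rpow {r y R : ℝ} (q : ℝ) (hr : 0 < r) (h1 : r ≤ y) (h2 : y ≤ R) :
    y ^ q ≤ r ^ q + R ^ q := by
  have hy : 0 < y := hr.trans_le h1
  have hR : 0 < R := hy.trans_le h2
  rcases le_total 0 q with hq | hq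
  · have := Real.rpow_le_rpow hy.le h2 hq
    have := Real.rpow_nonneg hr.le q
    linarith
  · have := Real.rpow_le_rpow_of_nonpos hr h1 hq
    have := Real.rpow_nonneg hR.le q
    linarith

theorem rpow_mul_lommelTerm (s a b : ℝ) {x : ℝ} (hx : 0 < x) (k : ℕ) :
    (x / 2) ^ s * lommelTerm a b x k = (x / 2) ^ (s + (a + b - 2 + 2 * (k : ℝ))) *
      ((Real.Gamma (k + a))⁻¹ * (Real.Gamma (k + b))⁻¹) := by
  rw [lommelTerm, Real.rpow_add (by positivity) s]
  ring

/-- The weight makes the k-th exponent `2(k + b - 1)`, so differentiation produces exactly the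
factor `k + b - 1` that lowers `Γ(k + b)` to `Γ(k + b - 1)`. -/
theorem hasDerivAt_rpow_mul_lommelG (a b : ℝ) {x : ℝ} (hx : 0 < x) :
    HasDerivAt (fun u => (u / 2) ^ (b - a) * lommelG a b u)
      ((x / 2) ^ (b - a) * lommelG a (b - 1) x) x := by
  have hsum := fun (y : ℝ) (hy : 0 < y) => (summable_lommelTerm a (b - 1) hy).abs
  have key := hasDerivAt_tsum_of_isPreconnected
    (g := fun (k : ℕ) (y : ℝ) => (y / 2) ^ (b - a + (a + b - 2 + 2 * (k : ℝ))) *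
      ((Real.Gamma (k + a))⁻¹ * (Real.Gamma (k + b))⁻¹))
    (g' := fun (k : ℕ) (y : ℝ) => (y / 2) ^ (b - a) * lommelTerm a (b - 1) y k)
    -- A power of either sign is monotone, so on the interval it is at most the sum of its endpoint
    -- values; both endpoint series converge.
    (u := fun k => (x / 2 / 2) ^ (b - a) * |lommelTerm a (b - 1) (x / 2) k| +
      (2 * x / 2) ^ (b - a) * |lommelTerm a (b - 1) (2 * x) k|)
    (t := Set.Ioo (x / 2) (2 * x)) (y₀ := x) (y := x)
    (((hsum _ (by positivity)).mul_left _).add ((hsum _ (by positivity)).mul_left _))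
    isOpen_Ioo isPreconnected_Ioo ?_ ?_ ⟨by linarith, by linarith⟩ ?_ ⟨by linarith, by linarith⟩
  · rw [tsum_mul_left] at key
    refine key.congr_of_eventuallyEq ?_
    filter_upwards [lt_mem_nhds hx] with y hy
    rw [lommelG, ← tsum_mul_left]
    exact tsum_congr (rpow_mul_lommelTerm _ a b hy)
  · intro k y hy
    have hy0 : 0 < y := lt_trans (by positivity) hy.1
    have h := (((hasDerivAt_id y).div_const 2).rpow_const
      (p := b - a + (a + b - 2 + 2 * (k : ℝ))) (Or.inl (by simp; positivity))).mul_const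
      ((Real.Gamma (k + a))⁻¹ * (Real.Gamma (k + b))⁻¹)
    refine h.congr_deriv ?_
    rw [rpow_mul_lommelTerm _ _ _ hy0, ← add_sub_assoc (k : ℝ) b 1, Real.inv_Gamma_sub_one]
    simp only [id]
    rw [show b - a + (a + (b - 1) - 2 + 2 * (k : ℝ)) = b - a + (a + b - 2 + 2 * (k : ℝ)) - 1 by ring]
    ring
  · intro k y hy
    have hy0 : 0 < y := lt_trans (by positivity) hy.1
    have habs : ∀ z : ℝ, 0 < z → (z / 2) ^ (b - a) * |lommelTerm a (b - 1) z k| =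
        (z / 2) ^ (b - a + (a + (b - 1) - 2 + 2 * (k : ℝ))) *
          |(Real.Gamma (k + a))⁻¹ * (Real.Gamma (k + (b - 1)))⁻¹| := by
      intro z hz
      have h1 : ∀ q : ℝ, |(z / 2) ^ q| = (z / 2) ^ q := fun q =>
        abs_of_nonneg (Real.rpow_nonneg (by positivity) q)
      rw [← h1 (b - a), ← abs_mul, rpow_mul_lommelTerm _ _ _ hz, abs_mul, h1]
    rw [habs _ (by positivity), habs _ (by positivity), Real.norm_eq_abs, abs_mul,
      abs_of_nonneg (Real.rpow_nonneg (by positivity) _), habs _ hy0, ← add_mul]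
    refine mul_le_mul_of_nonneg_right ?_ (abs_nonneg _)
    exact Real.rpow_le_rpow_add_rpow _ (by positivity) (by linarith [hy.1]) (by linarith [hy.2])
  · exact ((summable_lommelTerm a b hx).mul_left ((x / 2) ^ (b - a))).congr
      fun k => rpow_mul_lommelTerm _ a b hx k

theorem hasDerivAt_lommelG (a b : ℝ) {x : ℝ} (hx : 0 < x) :
    HasDerivAt (lommelG a b) (lommelG a (b - 1) x - (b - a) / x * lommelG a b x) x := by
  have hx2 : 0 < x / 2 := by positivity
  have h1 := ((hasDerivAt_id x).div_const 2).rpow_const (p := a - b)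
    (Or.inl (by simp; positivity))
  have h2 := h1.mul (hasDerivAt_rpow_mul_lommelG a b hx)
  have e : ∀ y : ℝ, 0 < y → (y / 2) ^ (a - b) * (y / 2) ^ (b - a) = 1 := fun y hy => by
    rw [← Real.rpow_add (by positivity)]; simp
  have h3 := h2.congr_of_eventuallyEq (f₁ := lommelG a b) (by
    filter_upwards [lt_mem_nhds hx] with y hy
    simp only [Pi.mul_apply, id]
    rw [← mul_assoc, e y hy, one_mul])
  refine h3.congr_deriv ?_
  simp only [id]
  rw [Real.rpow_sub_one hx2.ne']
  have := e x hx
  field_simp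
  linear_combination (x * lommelG a (b - 1) x - (b - a) * lommelG a b x) * this

/-- By symmetry the derivative can be computed by lowering either parameter; the two answers must
agree. -/
theorem lommelG_sub_lommelG (a b : ℝ) {x : ℝ} (hx : 0 < x) :
    lommelG a (b - 1) x - lommelG (a - 1) b x = 2 * (b - a) / x * lommelG a b x := by
  have h1 := hasDerivAt_lommelG a b hx
  have h2 := hasDerivAt_lommelG b a hx
  rw [show lommelG b a = lommelG a b from funext fun y => lommelG_comm b a y] at h2
  have h3 := h1.unique h2
  rw [lommelG_comm b (a - 1)] at h3
  field_simp at h3 ⊢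
  linarith

/-- The three-term recurrence in the second parameter. -/
theorem lommelG_recurrence (a b : ℝ) {x : ℝ} (hx : 0 < x) :
    lommelG a (b - 1) x = lommelG a (b + 1) x + 2 * (b - a) / x * lommelG a b x +
      (x / 2) ^ (a + b - 3) / (Real.Gamma (a - 1) * Real.Gamma b) := by
  have h1 := lommelG_sub_lommelG a b hx
  have h2 := lommelG_eq_add (a - 1) b hx
  rw [sub_add_cancel, show a - 1 + b - 2 = a + b - 3 by ring] at h2
  linarith

/-! ### Comparison of neighbouring parameters -/

/-- With z = (x/2)/(k+b), raising `b` multiplies the k-th summand by z ≤ (1 + z²)/2, and z² times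
that summand is at most `C` times the next one. Summation yields the average of the full series and
`C` times its tail. -/
theorem lommelG_add_one_le_of_le_mul {a b x C : ℝ} (ha : 0 ≤ a) (hb : 0 < b) (hx : 0 < x)
    (hC : 1 ≤ C) (hab : a ≤ C * b) :
    lommelG a (b + 1) x ≤ (lommelG a b x +
      C * (lommelG a b x - (x / 2) ^ (a + b - 2) / (Real.Gamma a * Real.Gamma b))) / 2 := by
  have hs := summable_lommelTerm a b hx
  have hs' := (summable_nat_add_iff 1).2 hs
  have h0 : lommelG a b x - (x / 2) ^ (a + b - 2) / (Real.Gamma a * Real.Gamma b) =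
      ∑' k, lommelTerm a b x (k + 1) := by
    rw [lommelG, hs.tsum_eq_zero_add]
    simp [lommelTerm]
  rw [h0, lommelG, lommelG, ← tsum_mul_left, ← hs.tsum_add (hs'.mul_left C), ← tsum_div_const]
  refine (summable_lommelTerm a (b + 1) hx).tsum_le_tsum (fun k => ?_)
    ((hs.add (hs'.mul_left C)).div_const 2)
  have hkb : 0 < (k : ℝ) + b := by positivity
  -- Equality means `k = 0` and `a = 0`, where the summand on the left vanishes.
  rcases eq_or_lt_of_le (show 0 ≤ (k : ℝ) + a by positivity) with hka | hka
  · have h1 := lommelTerm_nonneg ha hb.le hx k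
    have h2 := lommelTerm_nonneg ha hb.le hx (k + 1)
    rw [show lommelTerm a (b + 1) x k = 0 by rw [lommelTerm, ← hka]; simp [Real.Gamma_zero]]
    positivity
  · have hx2 : 0 < x / 2 := by positivity
    have hT := lommelTerm_pos hka hkb hx
    have e1 : lommelTerm a (b + 1) x k = lommelTerm a b x k * (x / 2) / (k + b) := by
      rw [lommelTerm, lommelTerm, ← add_assoc (k : ℝ) b 1, Real.Gamma_add_one hkb.ne',
        show a + (b + 1) - 2 + 2 * (k : ℝ) = a + b - 2 + 2 * (k : ℝ) + 1 by ring,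
        Real.rpow_add_one hx2.ne']
      have := Real.Gamma_pos_of_pos hka
      have := Real.Gamma_pos_of_pos hkb
      field_simp
    have e2 : lommelTerm a b x (k + 1) =
        lommelTerm a b x k * (x / 2) ^ 2 / ((k + a) * (k + b)) := by
      rw [lommelTerm, lommelTerm]
      push_cast
      rw [show (k : ℝ) + 1 + a = k + a + 1 by ring, show (k : ℝ) + 1 + b = k + b + 1 by ring,
        Real.Gamma_add_one hka.ne', Real.Gamma_add_one hkb.ne',
        show a + b - 2 + 2 * ((k : ℝ) + 1) = a + b - 2 + 2 * (k : ℝ) + (2 : ℕ) by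
          push_cast; ring,
        Real.rpow_add_natCast hx2.ne']
      have := Real.Gamma_pos_of_pos hka
      have := Real.Gamma_pos_of_pos hkb
      field_simp
    rw [e1, e2]
    have hle : 1 / ((k : ℝ) + b) ≤ C / (k + a) := by
      rw [div_le_div_iff₀ hkb hka]
      nlinarith [(Nat.cast_nonneg k : (0 : ℝ) ≤ k)]
    have hz : 0 < x / 2 / (k + b) := by positivity
    calc lommelTerm a b x k * (x / 2) / (k + b)
        = lommelTerm a b x k * (x / 2 / (k + b)) := by ring
      _ ≤ lommelTerm a b x k * ((1 + (x / 2 / (k + b)) ^ 2) / 2) := by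
          exact mul_le_mul_of_nonneg_left (by nlinarith [sq_nonneg (x / 2 / (k + b) - 1)]) hT.le
      _ = (lommelTerm a b x k + lommelTerm a b x k * (x / 2) ^ 2 / (k + b) * (1 / (k + b))) / 2 := by
          ring
      _ ≤ (lommelTerm a b x k + lommelTerm a b x k * (x / 2) ^ 2 / (k + b) * (C / (k + a))) / 2 := by
          gcongr
      _ = _ := by field_simp

theorem lommelG_add_one_le_mul {a b x C : ℝ} (ha : 0 ≤ a) (hb : 0 < b) (hx : 0 < x)
    (hC : 1 ≤ C) (hab : a ≤ C * b) : lommelG a (b + 1) x ≤ C * lommelG a b x := by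
  have h := lommelG_add_one_le_of_le_mul ha hb hx hC hab
  have h1 := lommelG_nonneg ha hb.le hx
  have h2 : 0 ≤ (x / 2) ^ (a + b - 2) / (Real.Gamma a * Real.Gamma b) := by
    have := Real.Gamma_nonneg_of_nonneg ha
    have := Real.Gamma_pos_of_pos hb
    positivity
  nlinarith

theorem lommelG_add_one_le {a b x : ℝ} (ha : 0 ≤ a) (hb : 0 < b) (hx : 0 < x) (hab : a ≤ b) :
    lommelG a (b + 1) x ≤ lommelG a b x := by
  simpa using lommelG_add_one_le_mul ha hb hx le_rfl (by simpa using hab)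

theorem lommelG_add_one_lt {a b x : ℝ} (ha : 0 < a) (hb : 0 < b) (hx : 0 < x) (hab : a ≤ b) :
    lommelG a (b + 1) x < lommelG a b x := by
  have h := lommelG_add_one_le_of_le_mul ha.le hb hx le_rfl (by simpa using hab)
  have h2 : 0 < (x / 2) ^ (a + b - 2) / (Real.Gamma a * Real.Gamma b) := by
    have := Real.Gamma_pos_of_pos ha
    have := Real.Gamma_pos_of_pos hb
    positivity
  linarith

/-- A unit step costs at most `D = max 1 (a/b)`, and nothing once `b + k ≥ a`; hence only boundedly
many steps cost anything and `C` is uniform in `k`. -/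
theorem exists_forall_lommelG_add_natCast_le {a b : ℝ} (ha : 0 ≤ a) (hb : 0 < b) :
    ∃ C : ℝ, 0 < C ∧ ∀ (k : ℕ) (x : ℝ), 0 < x → lommelG a (b + k) x ≤ C * lommelG a b x := by
  obtain ⟨n, hn⟩ := exists_nat_ge a
  set D := max 1 (a / b) with hD
  have hD1 : 1 ≤ D := le_max_left _ _
  have hDb : a ≤ D * b := (div_le_iff₀ hb).1 (le_max_right _ _)
  have hpow : ∀ (k : ℕ) (x : ℝ), 0 < x → lommelG a (b + k) x ≤ D ^ k * lommelG a b x := by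
    intro k x hx
    induction k with
    | zero => simp
    | succ k ih =>
      have h := lommelG_add_one_le_mul ha (b := b + k) (by positivity) hx hD1
        (hDb.trans (by gcongr; simp))
      push_cast
      rw [← add_assoc, pow_succ', mul_assoc]
      exact h.trans (by gcongr)
  refine ⟨D ^ n, by positivity, fun k x hx => ?_⟩
  have hG := lommelG_nonneg ha hb.le hx
  rcases le_total k n with hk | hk
  · exact (hpow k x hx).trans (by gcongr)
  · induction k, hk using Nat.le_induction with
    | base => exact hpow n x hx
    | succ k hk ih =>
      refine le_trans ?_ ih
      push_cast
      rw [← add_assoc]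
      refine lommelG_add_one_le ha (by positivity) hx ?_
      have : (n : ℝ) ≤ k := by exact_mod_cast hk
      linarith

/-- Controls the growth at 0: the leading power is the smallest one in the series. -/
theorem lommelG_le_rpow_mul {a b u x : ℝ} (ha : 0 ≤ a) (hb : 0 ≤ b) (hu : 0 < u) (hux : u ≤ x) :
    lommelG a b u ≤ (u / x) ^ (a + b - 2) * lommelG a b x := by
  have hx := hu.trans_le hux
  rw [lommelG, lommelG, ← tsum_mul_left]
  refine (summable_lommelTerm a b hu).tsum_le_tsum (fun k => ?_)
    ((summable_lommelTerm a b hx).mul_left _)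
  have h1 : 0 ≤ Real.Gamma (k + a) := Real.Gamma_nonneg_of_nonneg (by positivity)
  have h2 : 0 ≤ Real.Gamma (k + b) := Real.Gamma_nonneg_of_nonneg (by positivity)
  rw [lommelTerm, lommelTerm, ← mul_div_assoc]
  gcongr
  rw [show u / 2 = u / x * (x / 2) by field_simp, Real.mul_rpow (by positivity) (by positivity),
    Real.rpow_add (by positivity : 0 < u / x), mul_assoc]
  gcongr
  refine mul_le_of_le_one_left (by positivity) ?_
  exact Real.rpow_le_one (by positivity) ((div_le_one hx).2 hux) (by positivity)


/-! ### A l'Hôpital rule for integrals -/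

open MeasureTheory in
-- Beyond some `M` the integrand `f - c g` is at most `(ε/2) g` in absolute value; its integral over
-- `[0, M]` is a constant, absorbed by the divergence of `∫ g`.
theorem tendsto_integral_div_integral {f g : ℝ → ℝ} {c : ℝ}
    (hf : ∀ x, 0 < x → IntervalIntegrable f volume 0 x)
    (hg : ∀ x, 0 < x → IntervalIntegrable g volume 0 x)
    (hpos : ∀ x, 0 < x → 0 < g x)
    (hfg : Tendsto (fun x => f x / g x) atTop (𝓝 c))
    (htop : Tendsto (fun x => ∫ u in (0 : ℝ)..x, g u) atTop atTop) :
    Tendsto (fun x => (∫ u in (0 : ℝ)..x, f u) / ∫ u in (0 : ℝ)..x, g u) atTop (𝓝 c) := by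
  rw [Metric.tendsto_nhds]
  intro ε hε
  have h1 := (Metric.tendsto_nhds.1 hfg (ε / 2) (by positivity)).and (eventually_gt_atTop 0)
  obtain ⟨M, hM⟩ := eventually_atTop.1 h1
  have hM0 : 0 < M := (hM M le_rfl).2
  set G := fun x => ∫ u in (0 : ℝ)..x, g u with hG
  set A := |∫ u in (0 : ℝ)..M, (f u - c * g u)| with hA
  filter_upwards [htop.eventually_gt_atTop (2 * A / ε), htop.eventually_gt_atTop 0,
    eventually_ge_atTop M] with x hx1 hx0 hxM
  have hx : 0 < x := hM0.trans_le hxM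
  have hsub : ∀ y z, 0 < y → 0 < z →
      IntervalIntegrable (fun u => f u - c * g u) volume y z := fun y z hy hz =>
    ((hf y hy).symm.trans (hf z hz)).sub (((hg y hy).symm.trans (hg z hz)).const_mul c)
  have hsub0 : ∀ z, 0 < z → IntervalIntegrable (fun u => f u - c * g u) volume 0 z :=
    fun z hz => (hf z hz).sub ((hg z hz).const_mul c)
  have e1 : (∫ u in (0 : ℝ)..x, f u) - c * G x = ∫ u in (0 : ℝ)..x, (f u - c * g u) := by
    rw [intervalIntegral.integral_sub (hf x hx) ((hg x hx).const_mul c),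
      intervalIntegral.integral_const_mul]
  have e2 : (∫ u in (0 : ℝ)..x, (f u - c * g u)) =
      (∫ u in (0 : ℝ)..M, (f u - c * g u)) + ∫ u in M..x, (f u - c * g u) :=
    (intervalIntegral.integral_add_adjacent_intervals (hsub0 M hM0) (hsub M x hM0 hx)).symm
  have e3 : |∫ u in M..x, (f u - c * g u)| ≤ ε / 2 * G x := by
    have hgM : IntervalIntegrable g volume M x := (hg M hM0).symm.trans (hg x hx)
    have b1 : ‖∫ u in M..x, (f u - c * g u)‖ ≤ ∫ u in M..x, ε / 2 * g u := by
      refine intervalIntegral.norm_integral_le_of_norm_le hxM ?_ (hgM.const_mul _)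
      refine Eventually.of_forall fun u hu => ?_
      have hgu := hpos u (hM0.trans hu.1)
      have h2 := (hM u hu.1.le).1
      rw [Real.dist_eq, div_sub' hgu.ne', abs_div, abs_of_pos hgu, div_lt_iff₀ hgu] at h2
      rw [Real.norm_eq_abs, mul_comm c]
      exact h2.le
    rw [intervalIntegral.integral_const_mul] at b1
    have b2 : G x = (∫ u in (0 : ℝ)..M, g u) + ∫ u in M..x, g u :=
      (intervalIntegral.integral_add_adjacent_intervals (hg M hM0) hgM).symm
    have b3 : 0 ≤ ∫ u in (0 : ℝ)..M, g u :=
      (intervalIntegral.intervalIntegral_pos_of_pos_on (hg M hM0)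
        (fun u hu => hpos u hu.1) hM0).le
    refine b1.trans ?_
    gcongr
    linarith
  have hx0' : 0 < G x := hx0
  rw [Real.dist_eq, div_sub' hx0'.ne', abs_div, abs_of_pos hx0', div_lt_iff₀ hx0', mul_comm (G x),
    e1, e2]
  rw [div_lt_iff₀ hε] at hx1
  have hx1' : 2 * A < G x * ε := hx1
  refine (abs_add_le _ _).trans_lt ?_
  linarith

/-! ### Weighted functions and their integrals -/

/-- The weighted function `e^{-βx} x^s lommelG a b x`. -/
def lommelW (β s a b x : ℝ) : ℝ := Real.exp (-(β * x)) * x ^ s * lommelG a b x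

/-- The integral of `lommelW` over `[0, x]`. -/
def lommelJ (β s a b x : ℝ) : ℝ := ∫ u in (0 : ℝ)..x, lommelW β s a b u

theorem lommelW_pos (β s : ℝ) {a b x : ℝ} (ha : 0 ≤ a) (hb : 0 ≤ b) (hx : 0 < x) :
    0 < lommelW β s a b x := by
  have := lommelG_pos ha hb hx
  rw [lommelW]
  positivity

theorem hasDerivAt_lommelW (β s a b : ℝ) {x : ℝ} (hx : 0 < x) :
    HasDerivAt (lommelW β s a b)
      (lommelW β s a (b - 1) x + (s - (b - a)) * lommelW β (s - 1) a b x -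
        β * lommelW β s a b x) x := by
  have h1 : HasDerivAt (fun x : ℝ => Real.exp (-(β * x))) (Real.exp (-(β * x)) * -(β * 1)) x :=
    ((hasDerivAt_id x).const_mul β).neg.exp
  have h2 : HasDerivAt (fun x : ℝ => x ^ s) (s * x ^ (s - 1)) x :=
    Real.hasDerivAt_rpow_const (Or.inl hx.ne')
  refine ((h1.mul h2).mul (hasDerivAt_lommelG a b hx)).congr_deriv ?_
  simp only [lommelW, Pi.mul_apply]
  rw [Real.rpow_sub_one hx.ne']
  field_simp
  ring

theorem continuousOn_lommelW (β s a b : ℝ) : ContinuousOn (lommelW β s a b) (Set.Ioi 0) :=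
  fun _ hx => (hasDerivAt_lommelW β s a b hx).continuousAt.continuousWithinAt

theorem lommelW_le {β s a b u x : ℝ} (hβ : 0 ≤ β) (ha : 0 ≤ a) (hb : 0 ≤ b) (hu : 0 < u)
    (hux : u ≤ x) : lommelW β s a b u ≤
      lommelG a b x / x ^ (a + b - 2) * u ^ (s + a + b - 2) := by
  have hx := hu.trans_le hux
  have h := lommelG_le_rpow_mul ha hb hu hux
  have hG := lommelG_nonneg ha hb hu
  have he : Real.exp (-(β * u)) ≤ 1 := Real.exp_le_one_iff.2 (by nlinarith)
  calc lommelW β s a b u ≤ 1 * u ^ s * ((u / x) ^ (a + b - 2) * lommelG a b x) := by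
        rw [lommelW]; gcongr
    _ = _ := by
        rw [show s + a + b - 2 = s + (a + b - 2) by ring, Real.rpow_add hu,
          Real.div_rpow hu.le hx.le]
        ring

theorem tendsto_lommelW_zero {β s a b : ℝ} (hβ : 0 ≤ β) (ha : 0 ≤ a) (hb : 0 ≤ b)
    (hs : 0 < s + a + b - 2) : Tendsto (lommelW β s a b) (𝓝[>] 0) (𝓝 0) := by
  have h1 : Tendsto (fun u : ℝ => lommelG a b 1 / 1 ^ (a + b - 2) * u ^ (s + a + b - 2))
      (𝓝[>] 0) (𝓝 0) := by
    have := ((Real.continuousAt_rpow_const 0 _ (Or.inr hs.le)).tendsto.const_mul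
      (lommelG a b 1 / 1 ^ (a + b - 2))).mono_left (nhdsWithin_le_nhds (s := Set.Ioi (0 : ℝ)))
    rwa [Real.zero_rpow hs.ne', mul_zero] at this
  refine tendsto_of_tendsto_of_tendsto_of_le_of_le' tendsto_const_nhds h1 ?_ ?_
  · filter_upwards [self_mem_nhdsWithin] with u hu using (lommelW_pos β s ha hb hu).le
  · filter_upwards [Ioo_mem_nhdsGT (zero_lt_one' ℝ)] with u hu
    exact lommelW_le hβ ha hb hu.1 hu.2.le

theorem intervalIntegrable_lommelW {β s a b x : ℝ} (hβ : 0 ≤ β) (ha : 0 ≤ a) (hb : 0 ≤ b)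
    (hs : 0 < s + a + b - 1) (hx : 0 < x) :
    IntervalIntegrable (lommelW β s a b) MeasureTheory.volume 0 x := by
  have h1 : IntervalIntegrable (fun u : ℝ => u ^ (s + a + b - 2)) MeasureTheory.volume 0 x :=
    intervalIntegral.intervalIntegrable_rpow' (by linarith)
  refine (h1.const_mul (lommelG a b x / x ^ (a + b - 2))).mono_fun' ?_ ?_
  · rw [Set.uIoc_of_le hx.le]
    exact ((continuousOn_lommelW β s a b).mono fun u hu => hu.1).aestronglyMeasurable
      measurableSet_Ioc
  · rw [Set.uIoc_of_le hx.le]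
    refine (MeasureTheory.ae_restrict_iff' measurableSet_Ioc).2 (Eventually.of_forall fun u hu => ?_)
    dsimp only
    rw [Real.norm_of_nonneg (lommelW_pos β s ha hb hu.1).le]
    exact lommelW_le hβ ha hb hu.1 hu.2

theorem lommelJ_pos {β s a b x : ℝ} (hβ : 0 ≤ β) (ha : 0 ≤ a) (hb : 0 ≤ b)
    (hs : 0 < s + a + b - 1) (hx : 0 < x) : 0 < lommelJ β s a b x :=
  intervalIntegral.intervalIntegral_pos_of_pos_on (intervalIntegrable_lommelW hβ ha hb hs hx)
    (fun _ hu => lommelW_pos β s ha hb hu.1) hx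

/-- Integration by parts for `lommelW`. -/
theorem lommelW_eq_lommelJ {β s a b x : ℝ} (hβ : 0 ≤ β) (ha : 0 ≤ a) (hb : 1 ≤ b)
    (hs : 0 < s + a + b - 2) (hx : 0 < x) :
    lommelW β s a b x = lommelJ β s a (b - 1) x + (s - (b - a)) * lommelJ β (s - 1) a b x -
      β * lommelJ β s a b x := by
  have i1 := intervalIntegrable_lommelW (s := s) hβ ha (sub_nonneg.2 hb) (by linarith) hx
  have i2 := intervalIntegrable_lommelW (s := s - 1) hβ ha (zero_le_one.trans hb) (by linarith) hx
  have i3 := intervalIntegrable_lommelW (s := s) hβ ha (zero_le_one.trans hb) (by linarith) hx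
  have h := intervalIntegral.integral_eq_sub_of_hasDerivAt_of_tendsto hx
    (fun u hu => hasDerivAt_lommelW β s a b hu.1)
    ((i1.add (i2.const_mul (s - (b - a)))).sub (i3.const_mul β))
    (tendsto_lommelW_zero hβ ha (zero_le_one.trans hb) hs)
    ((hasDerivAt_lommelW β s a b hx).continuousAt.tendsto.mono_left nhdsWithin_le_nhds)
  rw [intervalIntegral.integral_sub (i1.add (i2.const_mul _)) (i3.const_mul β),
    intervalIntegral.integral_add i1 (i2.const_mul _), intervalIntegral.integral_const_mul,
    intervalIntegral.integral_const_mul, sub_zero] at h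
  exact h.symm

/-! ### Behaviour at infinity -/

/-- The function grows at least like e^x times a power. Choose `d = b + n ≥ a`; with exponent `p = d
+ 1 - a` the middle term of the derivative of e^{-x} x^p G_{a,d+1} vanishes, leaving e^{-x} x^p
(G_{a,d} - G_{a,d+1}) ≥ 0. The uniform comparison constant then carries the growth back to `b`. -/
theorem tendsto_lommelW_atTop {β : ℝ} (s : ℝ) {a b : ℝ} (hβ : β < 1) (ha : 0 ≤ a) (hb : 0 < b) :
    Tendsto (lommelW β s a b) atTop atTop := by
  obtain ⟨n, hn⟩ := exists_nat_ge a
  obtain ⟨C, hC, hCle⟩ := exists_forall_lommelG_add_natCast_le ha hb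
  set d := b + n with hd
  set p := d + 1 - a with hp
  have hmono : MonotoneOn (lommelW 1 p a (d + 1)) (Set.Ici 1) := by
    have hpos : ∀ x ∈ Set.Ici (1 : ℝ), 0 < x := fun x hx => zero_lt_one.trans_le hx
    refine monotoneOn_of_hasDerivWithinAt_nonneg (convex_Ici 1)
      ((continuousOn_lommelW _ _ _ _).mono hpos)
      (fun x hx => (hasDerivAt_lommelW 1 p a (d + 1)
        (hpos x (interior_subset hx))).hasDerivWithinAt) (fun x hx => ?_)
    have hx0 := hpos x (interior_subset hx)
    have h := lommelG_add_one_le (b := d) ha (by positivity) hx0 (by linarith)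
    rw [sub_self, zero_mul, add_zero, one_mul, add_sub_cancel_right, sub_nonneg, lommelW, lommelW]
    gcongr
  set c := lommelW 1 p a (d + 1) 1
  have hc : 0 < c := lommelW_pos _ _ ha (by positivity) one_pos
  have hlim : Tendsto (fun x : ℝ => c / C * (Real.exp ((1 - β) * x) / x ^ (p - s))) atTop atTop :=
    (tendsto_exp_mul_div_rpow_atTop (p - s) (1 - β) (sub_pos.2 hβ)).const_mul_atTop (by positivity)
  refine tendsto_atTop_mono' _ ?_ hlim
  filter_upwards [eventually_ge_atTop 1] with x hx
  have hx0 : 0 < x := zero_lt_one.trans_le hx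
  have h1 : c ≤ lommelW 1 p a (d + 1) x := hmono (Set.mem_Ici.2 le_rfl) hx hx
  have h2 := hCle (n + 1) x hx0
  rw [show b + ((n + 1 : ℕ) : ℝ) = d + 1 by push_cast; ring] at h2
  calc c / C * (Real.exp ((1 - β) * x) / x ^ (p - s))
      ≤ lommelW 1 p a (d + 1) x / C * (Real.exp ((1 - β) * x) / x ^ (p - s)) := by gcongr
    _ = Real.exp (-(β * x)) * x ^ s * (lommelG a (d + 1) x / C) := by
        rw [lommelW, show -(β * x) = -(1 * x) + (1 - β) * x by ring, Real.exp_add,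
          Real.rpow_sub hx0 p s]
        field_simp
    _ ≤ Real.exp (-(β * x)) * x ^ s * lommelG a b x := by
        gcongr
        rwa [div_le_iff₀' hC]

theorem tendsto_rpow_div_lommelG (s : ℝ) {a b : ℝ} (ha : 0 ≤ a) (hb : 0 < b) :
    Tendsto (fun x => x ^ s / lommelG a b x) atTop (𝓝 0) := by
  refine (tendsto_lommelW_atTop (-s) zero_lt_one ha hb).inv_tendsto_atTop.congr' ?_
  filter_upwards [eventually_gt_atTop 0] with x hx
  simp [lommelW, Real.rpow_neg hx.le, div_eq_mul_inv, mul_comm]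

/-- Squeeze: the ratio is at most 1, while G_{a,b} ≤ G_{a,b-1} and the recurrence bound it below by
1 - 2(b-a)/x minus a power divided by G_{a,b}. -/
theorem tendsto_lommelG_ratio_of_le {a b : ℝ} (ha : 0 ≤ a) (hb : 1 < b) (hab : a + 1 ≤ b) :
    Tendsto (fun x => lommelG a (b + 1) x / lommelG a b x) atTop (𝓝 1) := by
  have h0 := (tendsto_rpow_div_lommelG (a + b - 3) ha (zero_lt_one.trans hb)).const_mul
    (1 / 2 ^ (a + b - 3) / (Real.Gamma (a - 1) * Real.Gamma b))
  have h1 : Tendsto (fun x : ℝ => 2 * (b - a) / x) atTop (𝓝 0) :=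
    tendsto_const_nhds.div_atTop tendsto_id
  have h2 := (h1.add h0).const_sub 1
  simp only [mul_zero, add_zero, sub_zero] at h2
  refine tendsto_of_tendsto_of_tendsto_of_le_of_le' h2 tendsto_const_nhds ?_ ?_
  · filter_upwards [eventually_gt_atTop 0] with x hx
    have hG := lommelG_pos ha (zero_le_one.trans hb.le) hx
    have hr := lommelG_recurrence a b hx
    have hle := lommelG_add_one_le (b := b - 1) ha (by linarith) hx (by linarith)
    rw [sub_add_cancel] at hle
    rw [Real.div_rpow hx.le zero_le_two] at hr
    rw [sub_le_iff_le_add, ← mul_le_mul_iff_left₀ hG]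
    have e : (lommelG a (b + 1) x / lommelG a b x + (2 * (b - a) / x +
        1 / 2 ^ (a + b - 3) / (Real.Gamma (a - 1) * Real.Gamma b) *
          (x ^ (a + b - 3) / lommelG a b x))) * lommelG a b x =
        lommelG a (b + 1) x + 2 * (b - a) / x * lommelG a b x +
          x ^ (a + b - 3) / 2 ^ (a + b - 3) / (Real.Gamma (a - 1) * Real.Gamma b) := by
      rw [add_mul, add_mul, div_mul_cancel₀ _ hG.ne', mul_assoc _ (_ / _),
        div_mul_cancel₀ _ hG.ne']
      ring
    rw [one_mul, e, ← hr]
    exact hle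
  · filter_upwards [eventually_gt_atTop 0] with x hx
    have hG := lommelG_pos ha (zero_le_one.trans hb.le) hx
    exact (div_le_one hG).2 (lommelG_add_one_le ha (by linarith) hx (by linarith))

/-- Dividing the recurrence at `b + 1` by G_{a,b+1} expresses the inverse ratio at `b` through the
ratio at `b + 1`. This descends from large `b`, where the squeeze applies. -/
theorem tendsto_lommelG_ratio_of_add_one {a b : ℝ} (ha : 0 ≤ a) (hb : 0 < b)
    (h : Tendsto (fun x => lommelG a (b + 1 + 1) x / lommelG a (b + 1) x) atTop (𝓝 1)) :
    Tendsto (fun x => lommelG a (b + 1) x / lommelG a b x) atTop (𝓝 1) := by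
  have h0 := (tendsto_rpow_div_lommelG (a + (b + 1) - 3) ha
    (add_pos hb one_pos)).const_mul
    (1 / 2 ^ (a + (b + 1) - 3) / (Real.Gamma (a - 1) * Real.Gamma (b + 1)))
  have h1 : Tendsto (fun x : ℝ => 2 * (b + 1 - a) / x) atTop (𝓝 0) :=
    tendsto_const_nhds.div_atTop tendsto_id
  have h2 := ((h.add h1).add h0).inv₀ (by simp)
  simp only [mul_zero, add_zero, inv_one] at h2
  refine h2.congr' ?_
  filter_upwards [eventually_gt_atTop 0] with x hx
  have hG := lommelG_pos ha hb.le hx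
  have hG1 := lommelG_pos ha (add_pos hb one_pos).le hx
  have hr := lommelG_recurrence a (b + 1) hx
  rw [add_sub_cancel_right, Real.div_rpow hx.le zero_le_two] at hr
  rw [← inv_div (lommelG a b x), hr]
  congr 1
  field_simp

theorem tendsto_lommelG_ratio {a b : ℝ} (ha : 0 ≤ a) (hb : 0 < b) :
    Tendsto (fun x => lommelG a (b + 1) x / lommelG a b x) atTop (𝓝 1) := by
  obtain ⟨n, hn⟩ := exists_nat_gt (a + 1)
  have key : ∀ (n : ℕ) (b : ℝ), 0 < b → a + 1 < b + n →
      Tendsto (fun x => lommelG a (b + 1) x / lommelG a b x) atTop (𝓝 1) := by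
    intro n
    induction n with
    | zero =>
      intro b hb h
      simp only [Nat.cast_zero, add_zero] at h
      exact tendsto_lommelG_ratio_of_le ha (by linarith) h.le
    | succ n ih =>
      intro b hb h
      push_cast at h
      exact tendsto_lommelG_ratio_of_add_one ha hb (ih (b + 1) (by linarith) (by linarith))
  exact key n b hb (by linarith)

theorem tendsto_lommelJ_atTop {β s a b : ℝ} (hβ0 : 0 ≤ β) (hβ1 : β < 1) (ha : 0 ≤ a) (hb : 0 < b)
    (hs : 0 < s + a + b - 1) : Tendsto (lommelJ β s a b) atTop atTop := by
  obtain ⟨M, hM⟩ := eventually_atTop.1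
    (((tendsto_lommelW_atTop s hβ1 ha hb).eventually_ge_atTop 1).and (eventually_gt_atTop 0))
  have hM0 : 0 < M := (hM M le_rfl).2
  refine tendsto_atTop_mono' _ ?_ (tendsto_atTop_add_const_right _ (-M) tendsto_id)
  filter_upwards [eventually_ge_atTop M] with x hx
  have i1 := intervalIntegrable_lommelW hβ0 ha hb.le hs hM0
  have i2 := intervalIntegrable_lommelW hβ0 ha hb.le hs (hM0.trans_le hx)
  have h1 := intervalIntegral.integral_mono_on hx (intervalIntegrable_const (c := (1 : ℝ)))
    (i1.symm.trans i2) (fun u hu => (hM u hu.1).1)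
  have h2 := lommelJ_pos hβ0 ha hb.le hs hM0
  rw [lommelJ, ← intervalIntegral.integral_add_adjacent_intervals i1 (i1.symm.trans i2)]
  rw [lommelJ] at h2
  simp only [intervalIntegral.integral_const, smul_eq_mul, mul_one] at h1
  simp only [id]
  linarith


/-! ### Estimate of the integral with exponent `ν - 1` -/

theorem integral_exp_mul_rpow_le {w δ K x : ℝ} (hw : -1 < w) (hδ : 0 < δ) (hK : 1 ≤ K)
    (hKw : 1 + w ≤ K) (hx : 0 < x) :
    ∫ u in (0 : ℝ)..x, Real.exp (δ * u) * u ^ w ≤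
      K / ((1 + w) * δ) * (Real.exp (δ * x) * x ^ w) := by
  have hw1 : 0 < 1 + w := by linarith
  have hxw : 0 < x ^ w := Real.rpow_pos_of_pos hx w
  have hE : ∀ u : ℝ, HasDerivAt (fun u : ℝ => Real.exp (δ * u)) (Real.exp (δ * u) * δ) u :=
    fun u => by simpa using ((hasDerivAt_id u).const_mul δ).exp
  have hint : MeasureTheory.IntegrableOn (fun u : ℝ => Real.exp (δ * u) * u ^ w) (Set.Icc 0 x) := by
    rw [← intervalIntegrable_iff_integrableOn_Icc_of_le hx.le]
    exact (intervalIntegral.intervalIntegrable_rpow' hw).continuousOn_mul (by fun_prop)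
  rcases le_total 0 w with hw0 | hw0
  · have h := intervalIntegral.integral_le_sub_of_hasDeriv_right_of_le hx.le
      (g := fun u => x ^ w / δ * Real.exp (δ * u)) (by fun_prop)
      (fun u _ => ((hE u).const_mul (x ^ w / δ)).hasDerivWithinAt) hint (fun u hu => by
        have : u ^ w ≤ x ^ w := Real.rpow_le_rpow hu.1.le hu.2.le hw0
        calc Real.exp (δ * u) * u ^ w ≤ Real.exp (δ * u) * x ^ w := by gcongr
          _ = _ := by field_simp)
    refine h.trans ?_
    have h2 : 0 ≤ x ^ w / δ * Real.exp (δ * 0) := by positivity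
    calc x ^ w / δ * Real.exp (δ * x) - x ^ w / δ * Real.exp (δ * 0)
        ≤ 1 / δ * (Real.exp (δ * x) * x ^ w) := by
          rw [sub_le_iff_le_add]; refine le_add_of_le_of_nonneg (le_of_eq ?_) h2; ring
      _ ≤ K / ((1 + w) * δ) * (Real.exp (δ * x) * x ^ w) := by
          refine mul_le_mul_of_nonneg_right ?_ (by positivity)
          rw [div_le_div_iff₀ hδ (by positivity)]
          nlinarith
  · have h := intervalIntegral.integral_le_sub_of_hasDeriv_right_of_le hx.le
      -- Integration by parts in disguise: (u - 1/δ) e^{δu} is a primitive of δ u e^{δu}, and for `w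
      -- ≤ 0` replacing `u ^ w` by the smaller `x ^ w` in the subtracted term only increases the
      -- derivative.
      (g := fun u => (Real.exp (δ * u) * u ^ (w + 1) -
        x ^ w * ((u - 1 / δ) * Real.exp (δ * u))) / (1 + w))
      (ContinuousOn.div_const (((by fun_prop : ContinuousOn (fun u : ℝ => Real.exp (δ * u)) _).mul
        (continuousOn_id.rpow_const fun _ _ => Or.inr (by linarith))).sub (by fun_prop)) _)
      (fun u hu => ((((hE u).mul (Real.hasDerivAt_rpow_const (p := w + 1) (Or.inl hu.1.ne'))).sub
        ((((hasDerivAt_id u).sub_const (1 / δ)).mul (hE u)).const_mul (x ^ w))).div_const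
          (1 + w)).hasDerivWithinAt) hint (fun u hu => by
        have h1 : x ^ w ≤ u ^ w := Real.rpow_le_rpow_of_nonpos hu.1 hu.2.le hw0
        have hu0 : 0 < u := hu.1
        simp only [id]
        rw [le_div_iff₀ hw1, add_sub_cancel_right, Real.rpow_add_one hu.1.ne']
        have h2 : x ^ w * (1 * Real.exp (δ * u) + (u - 1 / δ) * (Real.exp (δ * u) * δ)) =
            x ^ w * (Real.exp (δ * u) * δ * u) := by
          field_simp; ring
        have h3 : x ^ w * (Real.exp (δ * u) * δ * u) ≤ u ^ w * (Real.exp (δ * u) * δ * u) := by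
          gcongr
        rw [h2]
        linarith)
    refine h.trans ?_
    have e1 : x ^ (w + 1) = x ^ w * x := Real.rpow_add_one hx.ne' w
    have e2 : (0 : ℝ) ^ (w + 1) = 0 := Real.zero_rpow (by linarith)
    calc _ = (Real.exp (δ * x) * x ^ w - x ^ w) / ((1 + w) * δ) := by
          simp only [e1, e2, mul_zero, Real.exp_zero]
          field_simp
          ring
      _ ≤ K * (Real.exp (δ * x) * x ^ w) / ((1 + w) * δ) := by
          gcongr
          have : 0 < Real.exp (δ * x) * x ^ w := by positivity
          nlinarith
      _ = _ := by ring

theorem lommelW_comm (β s a b x : ℝ) : lommelW β s a b x = lommelW β s b a x := by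
  rw [lommelW, lommelW, lommelG_comm]

theorem hasDerivAt_lommelW_left (β s a b : ℝ) {x : ℝ} (hx : 0 < x) :
    HasDerivAt (lommelW β s a b)
      (lommelW β s (a - 1) b x + (s - (a - b)) * lommelW β (s - 1) a b x -
        β * lommelW β s a b x) x := by
  have h := hasDerivAt_lommelW β s b a hx
  rw [lommelW_comm β s b (a - 1), lommelW_comm β (s - 1) b a, lommelW_comm β s b a] at h
  rwa [show lommelW β s b a = lommelW β s a b from funext fun y => lommelW_comm β s b a y] at h

/-- The derivative of `e^{-x} √x lommelG a b x` is nonnegative, by the second-order differential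
inequality satisfied by `√x lommelG a b x`. -/
theorem lommelW_deriv_sqrt_nonneg {a b x : ℝ} (ha : 1 ≤ a) (hb : 1 ≤ b) (hab : 5 / 2 < a + b)
    (hν : 1 / 2 ≤ b - a) (hx : 0 < x) :
    0 ≤ lommelW 1 (1 / 2) a (b - 1) x + (1 / 2 - (b - a)) * lommelW 1 (1 / 2 - 1) a b x -
      lommelW 1 (1 / 2) a b x := by
  have ha0 : 0 ≤ a := zero_le_one.trans ha
  have hb0 : 0 ≤ b := zero_le_one.trans hb
  set Q := fun x => lommelW 1 (1 / 2) a (b - 1) x +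
    (1 / 2 - (b - a)) * lommelW 1 (1 / 2 - 1) a b x - lommelW 1 (1 / 2) a b x with hQ
  have hexp : ∀ y : ℝ, HasDerivAt (fun u : ℝ => Real.exp (2 * u)) (Real.exp (2 * y) * 2) y :=
    fun y => by simpa using ((hasDerivAt_id y).const_mul 2).exp
  -- For f = √x G_{a,b} one has `Q` = e^{-x}(f' - f), so e^{2x} `Q` has derivative e^x(f'' - f).
  -- Here f'' - f ≥ 0 because G_{a-1,b-1} ≥ G_{a,b} and ν² ≥ 1/4.
  have hder : ∀ y, 0 < y → HasDerivAt (fun u => Real.exp (2 * u) * Q u)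
      (Real.exp (2 * y) * (lommelW 1 (1 / 2) (a - 1) (b - 1) y - lommelW 1 (1 / 2) a b y +
        ((b - a) ^ 2 - 1 / 4) * lommelW 1 (1 / 2 - 1 - 1) a b y)) y := by
    intro y hy
    have h1 := hasDerivAt_lommelW_left 1 (1 / 2) a (b - 1) hy
    have h2 := hasDerivAt_lommelW 1 (1 / 2 - 1) a b hy
    have h3 := hasDerivAt_lommelW 1 (1 / 2) a b hy
    refine ((hexp y).mul ((h1.add (h2.const_mul (1 / 2 - (b - a)))).sub h3)).congr_deriv ?_
    simp only [Pi.add_apply, Pi.sub_apply]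
    ring
  have hmono : MonotoneOn (fun u => Real.exp (2 * u) * Q u) (Set.Ioi 0) := by
    refine monotoneOn_of_hasDerivWithinAt_nonneg (convex_Ioi 0)
      (fun y hy => (hder y hy).continuousAt.continuousWithinAt)
      (fun y hy => (hder y (interior_subset hy)).hasDerivWithinAt) (fun y hy => ?_)
    have hy0 : 0 < y := interior_subset hy
    refine mul_nonneg (Real.exp_nonneg _) (add_nonneg (sub_nonneg.2 ?_)
      (mul_nonneg (by nlinarith) (lommelW_pos _ _ ha0 hb0 hy0).le))
    have h := lommelG_eq_add (a - 1) (b - 1) hy0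
    rw [sub_add_cancel, sub_add_cancel] at h
    have h2 : 0 ≤ (y / 2) ^ (a - 1 + (b - 1) - 2) / (Real.Gamma (a - 1) * Real.Gamma (b - 1)) := by
      have := Real.Gamma_nonneg_of_nonneg (sub_nonneg.2 ha)
      have := Real.Gamma_nonneg_of_nonneg (sub_nonneg.2 hb)
      positivity
    rw [lommelW, lommelW]
    gcongr
    linarith
  have hlim : Tendsto (fun u => Real.exp (2 * u) * Q u) (𝓝[>] 0) (𝓝 0) := by
    have h0 : Tendsto (fun u : ℝ => Real.exp (2 * u)) (𝓝[>] 0) (𝓝 1) := by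
      have : ContinuousAt (fun u : ℝ => Real.exp (2 * u)) 0 := by fun_prop
      simpa using this.tendsto.mono_left (nhdsWithin_le_nhds (s := Set.Ioi (0 : ℝ)))
    have h1 := tendsto_lommelW_zero (β := 1) (s := 1 / 2) zero_le_one ha0 (sub_nonneg.2 hb)
      (by linarith)
    have h2 := tendsto_lommelW_zero (β := 1) (s := 1 / 2 - 1) zero_le_one ha0 hb0 (by linarith)
    have h3 := tendsto_lommelW_zero (β := 1) (s := 1 / 2) zero_le_one ha0 hb0 (by linarith)
    have h4 := h0.mul ((h1.add (h2.const_mul (1 / 2 - (b - a)))).sub h3)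
    rwa [mul_zero, add_zero, sub_zero, mul_zero] at h4
  have h : 0 ≤ Real.exp (2 * x) * Q x := by
    refine le_of_tendsto hlim ?_
    filter_upwards [Ioo_mem_nhdsGT hx] with u hu
    exact hmono hu.1 hx hu.2.le
  exact nonneg_of_mul_nonneg_right h (Real.exp_pos _)

theorem monotoneOn_lommelW_sqrt {a b : ℝ} (ha : 1 ≤ a) (hb : 1 ≤ b) (hab : 5 / 2 < a + b)
    (hν : 1 / 2 ≤ b - a) : MonotoneOn (lommelW 1 (1 / 2) a b) (Set.Ioi 0) := by
  refine monotoneOn_of_hasDerivWithinAt_nonneg (convex_Ioi 0) (continuousOn_lommelW _ _ _ _)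
    (fun y hy => (hasDerivAt_lommelW _ _ _ _ (interior_subset hy)).hasDerivWithinAt) (fun y hy => ?_)
  rw [one_mul]
  exact lommelW_deriv_sqrt_nonneg ha hb hab hν (interior_subset hy)

/-- The integrand is the monotone factor e^{-u} √u G_{a,b}(u) times e^{(1-β)u} u^{ν-3/2}; the first
is bounded by its value at `x` and the second is integrated by the elementary estimate. Convergence
at 0 needs ν > 1/2. -/
theorem lommelJ_le_mul_lommelW {β a b K x : ℝ} (hβ0 : 0 ≤ β) (hβ1 : β < 1) (ha : 1 ≤ a)
    (hb : 1 ≤ b) (hab : 5 / 2 < a + b) (hν : 1 / 2 < b - a) (hK : 1 ≤ K)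
    (hKν : b - a - 1 / 2 ≤ K) (hx : 0 < x) :
    lommelJ β (b - a - 1) a b x ≤
      K / ((b - a - 1 / 2) * (1 - β)) * lommelW β (b - a - 1) a b x := by
  have ha0 : 0 ≤ a := zero_le_one.trans ha
  have hb0 : 0 ≤ b := zero_le_one.trans hb
  have hW : ∀ u, 0 < u → lommelW β (b - a - 1) a b u =
      lommelW 1 (1 / 2) a b u * (Real.exp ((1 - β) * u) * u ^ (b - a - 3 / 2)) := by
    intro u hu
    rw [lommelW, lommelW, show -(β * u) = -(1 * u) + (1 - β) * u by ring, Real.exp_add,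
      show b - a - 1 = 1 / 2 + (b - a - 3 / 2) by ring, Real.rpow_add hu]
    ring
  have hmono := monotoneOn_lommelW_sqrt ha hb hab hν.le
  have hint : IntervalIntegrable (fun u : ℝ => Real.exp ((1 - β) * u) * u ^ (b - a - 3 / 2))
      MeasureTheory.volume 0 x :=
    (intervalIntegral.intervalIntegrable_rpow' (by linarith)).continuousOn_mul (by fun_prop)
  have h1 : lommelJ β (b - a - 1) a b x ≤ ∫ u in (0 : ℝ)..x, lommelW 1 (1 / 2) a b x *
      (Real.exp ((1 - β) * u) * u ^ (b - a - 3 / 2)) := by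
    refine intervalIntegral.integral_mono_on_of_le_Ioo hx.le
      (intervalIntegrable_lommelW hβ0 ha0 hb0 (by linarith) hx) (hint.const_mul _) (fun u hu => ?_)
    have hu0 : 0 < u := hu.1
    rw [hW u hu0]
    exact mul_le_mul_of_nonneg_right (hmono hu0 hx hu.2.le) (by positivity)
  rw [intervalIntegral.integral_const_mul] at h1
  have h2 := integral_exp_mul_rpow_le (w := b - a - 3 / 2) (K := K) (by linarith)
    (sub_pos.2 hβ1) hK (by linarith) hx
  have h3 := (lommelW_pos 1 (1 / 2) ha0 hb0 hx).le
  refine h1.trans ((mul_le_mul_of_nonneg_left h2 h3).trans_eq ?_)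
  rw [hW x hx, show 1 + (b - a - 3 / 2) = b - a - 1 / 2 by ring]
  ring

/-! ### The inhomogeneous term -/

/-- The integrand of `lommelB` in the parameters `a`, `b`. -/
def lommelInhom (β a b u : ℝ) : ℝ :=
  Real.exp (-(β * u)) * u ^ (b - a) *
    ((u / 2) ^ (a + b - 3) / (Real.Gamma (a - 1) * Real.Gamma b))

theorem lommelInhom_eq (β a b : ℝ) {u : ℝ} (hu : 0 < u) :
    lommelInhom β a b u = 1 / (2 ^ (a + b - 3) * Real.Gamma (a - 1) * Real.Gamma b) *
      (Real.exp (-(β * u)) * u ^ (2 * b - 3)) := by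
  rw [lommelInhom, Real.div_rpow hu.le zero_le_two,
    show 2 * b - 3 = b - a + (a + b - 3) by ring, Real.rpow_add hu]
  ring

theorem lommelB_eq_integral (μ ν x : ℝ) {β : ℝ} (hβ : 0 < β) (hx : 0 < x) :
    lommelB μ ν β x =
      ∫ u in (0 : ℝ)..x, lommelInhom β ((μ - ν + 3) / 2) ((μ + ν + 3) / 2) u := by
  have h1 := intervalIntegral.integral_comp_mul_left (a := 0) (b := x)
    (fun v : ℝ => Real.exp (-v) * v ^ (μ + ν + 1 - 1)) hβ.ne'
  rw [mul_zero, smul_eq_mul] at h1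
  have h2 : ∫ u in (0 : ℝ)..x, Real.exp (-(β * u)) * (β * u) ^ (μ + ν + 1 - 1) =
      β ^ (μ + ν) * ∫ u in (0 : ℝ)..x, Real.exp (-(β * u)) * u ^ (μ + ν) := by
    rw [← intervalIntegral.integral_const_mul]
    refine intervalIntegral.integral_congr_ae (Eventually.of_forall fun u hu => ?_)
    rw [Set.uIoc_of_le hx.le] at hu
    rw [add_sub_cancel_right, Real.mul_rpow hβ.le hu.1.le]
    ring
  have h3 : ∫ u in (0 : ℝ)..x, lommelInhom β ((μ - ν + 3) / 2) ((μ + ν + 3) / 2) u =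
      1 / (2 ^ μ * Real.Gamma ((μ - ν + 1) / 2) * Real.Gamma ((μ + ν + 3) / 2)) *
        ∫ u in (0 : ℝ)..x, Real.exp (-(β * u)) * u ^ (μ + ν) := by
    rw [← intervalIntegral.integral_const_mul]
    refine intervalIntegral.integral_congr_ae (Eventually.of_forall fun u hu => ?_)
    rw [Set.uIoc_of_le hx.le] at hu
    rw [lommelInhom_eq _ _ _ hu.1]
    ring_nf
  rw [h2, eq_inv_mul_iff_mul_eq₀ hβ.ne'] at h1
  rw [lommelB, lowerIncGamma, h3, ← h1]
  have h4 : β ^ (-μ - ν - 1) * (β * β ^ (μ + ν)) = 1 := by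
    rw [mul_comm β, ← Real.rpow_add_one hβ.ne', ← Real.rpow_add hβ,
      show -μ - ν - 1 + (μ + ν + 1) = 0 by ring, Real.rpow_zero]
  rw [← mul_assoc, ← mul_assoc, mul_assoc (β ^ (-μ - ν - 1)), h4]
  ring

theorem intervalIntegrable_lommelInhom {b x : ℝ} (β a : ℝ) (hb : 1 < b) (hx : 0 < x) :
    IntervalIntegrable (lommelInhom β a b) MeasureTheory.volume 0 x := by
  have h : IntervalIntegrable (fun u : ℝ => Real.exp (-(β * u)) * u ^ (2 * b - 3))
      MeasureTheory.volume 0 x :=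
    (intervalIntegral.intervalIntegrable_rpow' (by linarith)).continuousOn_mul (by fun_prop)
  refine (h.const_mul (1 / (2 ^ (a + b - 3) * Real.Gamma (a - 1) * Real.Gamma b))).congr
    (fun u hu => ?_)
  rw [Set.uIoc_of_le hx.le] at hu
  exact (lommelInhom_eq β a b hu.1).symm


/-! ### Bounds with the term `B` -/

theorem lommelW_sub_add_lommelJ {β a b x : ℝ} (hβ : 0 ≤ β) (ha : 0 ≤ a) (hb : 1 < b)
    (hx : 0 < x) :
    lommelW β (b - a) a b x = lommelJ β (b - a) a (b - 1) x - β * lommelJ β (b - a) a b x := by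
  have h := lommelW_eq_lommelJ (s := b - a) hβ ha hb.le (by linarith) hx
  rwa [sub_self, zero_mul, add_zero] at h

theorem lommelJ_sub_one_eq {β a b x : ℝ} (hβ : 0 ≤ β) (ha : 0 ≤ a) (hb : 1 < b) (hx : 0 < x) :
    lommelJ β (b - a) a (b - 1) x = lommelJ β (b - a) a (b + 1) x +
      2 * (b - a) * lommelJ β (b - a - 1) a b x + ∫ u in (0 : ℝ)..x, lommelInhom β a b u := by
  have hb0 : 0 ≤ b := by linarith
  have i1 := intervalIntegrable_lommelW (s := b - a) (b := b + 1) hβ ha (by linarith)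
    (by linarith) hx
  have i2 := intervalIntegrable_lommelW (s := b - a - 1) hβ ha hb0 (by linarith) hx
  have i3 := intervalIntegrable_lommelInhom β a hb hx
  rw [lommelJ, lommelJ, lommelJ, ← intervalIntegral.integral_const_mul,
    ← intervalIntegral.integral_add i1 (i2.const_mul _),
    ← intervalIntegral.integral_add (i1.add (i2.const_mul _)) i3]
  refine intervalIntegral.integral_congr_ae (Eventually.of_forall fun u hu => ?_)
  rw [Set.uIoc_of_le hx.le] at hu
  simp only [lommelW, lommelInhom]
  rw [lommelG_recurrence a b hu.1, Real.rpow_sub_one hu.1.ne']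
  ring

theorem lommelJ_add_one_lt {β a b x : ℝ} (hβ : 0 ≤ β) (ha : 0 < a) (hb : 1 < b) (hab : a ≤ b)
    (hx : 0 < x) : lommelJ β (b - a) a (b + 1) x < lommelJ β (b - a) a b x := by
  have i1 := intervalIntegrable_lommelW (s := b - a) (b := b + 1) hβ ha.le (by linarith)
    (by linarith) hx
  have i2 := intervalIntegrable_lommelW (s := b - a) (b := b) hβ ha.le (by linarith)
    (by linarith) hx
  rw [← sub_pos, lommelJ, lommelJ, ← intervalIntegral.integral_sub i2 i1]
  refine intervalIntegral.intervalIntegral_pos_of_pos_on (i2.sub i1) (fun u hu => ?_) hx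
  have hu0 : 0 < u := hu.1
  have h := lommelG_add_one_lt (b := b) ha (by linarith) hu0 hab
  rw [sub_pos, lommelW, lommelW]
  gcongr

/-- Pointwise: G_{a,b-1} is its first summand plus G_{a+1,b}, and G_{a+1,b} < G_{a,b} since `b ≤ a`.
The first summand is at most the inhomogeneous power because 1/(a-1) ≤ 1/(b-1). -/
theorem lommelJ_sub_one_lt {β a b x : ℝ} (hβ : 0 ≤ β) (ha : 1 < a) (hb : 1 < b) (hab : b ≤ a)
    (hx : 0 < x) : lommelJ β (b - a) a (b - 1) x <
      lommelJ β (b - a) a b x + ∫ u in (0 : ℝ)..x, lommelInhom β a b u := by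
  have ha0 : 0 < a := zero_lt_one.trans ha
  have i1 := intervalIntegrable_lommelW (s := b - a) (b := b - 1) hβ ha0.le (by linarith)
    (by linarith) hx
  have i2 := intervalIntegrable_lommelW (s := b - a) (b := b) hβ ha0.le (by linarith)
    (by linarith) hx
  have i3 := intervalIntegrable_lommelInhom β a hb hx
  rw [← sub_pos, lommelJ, lommelJ, ← intervalIntegral.integral_add i2 i3,
    ← intervalIntegral.integral_sub (i2.add i3) i1]
  refine intervalIntegral.intervalIntegral_pos_of_pos_on ((i2.add i3).sub i1) (fun u hu => ?_) hx
  have hu0 : 0 < u := hu.1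
  have h1 := lommelG_add_one_lt (a := b) (b := a) (by linarith) ha0 hu0 hab
  rw [lommelG_comm b, lommelG_comm b] at h1
  have h2 := lommelG_eq_add a (b - 1) hu0
  rw [sub_add_cancel, show a + (b - 1) - 2 = a + b - 3 by ring] at h2
  have h3 : (u / 2) ^ (a + b - 3) / (Real.Gamma a * Real.Gamma (b - 1)) ≤
      (u / 2) ^ (a + b - 3) / (Real.Gamma (a - 1) * Real.Gamma b) := by
    have ga := Real.Gamma_add_one (sub_pos.2 ha).ne'
    have gb := Real.Gamma_add_one (sub_pos.2 hb).ne'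
    rw [sub_add_cancel] at ga gb
    have p1 := Real.Gamma_pos_of_pos (sub_pos.2 ha)
    have p2 := Real.Gamma_pos_of_pos (sub_pos.2 hb)
    rw [ga, gb]
    have : 0 < b - 1 := by linarith
    have p3 : 0 < Real.Gamma (a - 1) * Real.Gamma (b - 1) := mul_pos p1 p2
    refine div_le_div_of_nonneg_left (by positivity) (by positivity) ?_
    nlinarith
  have h4 : 0 < Real.exp (-(β * u)) * u ^ (b - a) := by positivity
  rw [sub_pos, lommelW, lommelW, lommelInhom, ← mul_add]
  exact mul_lt_mul_of_pos_left (by linarith) h4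

/-- The strict lower bound for nonnegative `ν = b - a`. -/
theorem lommelJ_lower_bound {β a b K x : ℝ} (hβ0 : 0 ≤ β) (hβ1 : β < 1) (ha : 1 < a)
    (hab : 5 / 2 < a + b) (hν : 1 / 2 < b - a) (hK : 1 ≤ K)
    (hKν : b - a - 1 / 2 ≤ K) (hx : 0 < x) :
    1 / (1 - β) * ((1 - 4 * (b - a) * K / ((2 * (b - a) - 1) * (1 - β)) * (1 / x)) *
      lommelW β (b - a) a b x - ∫ u in (0 : ℝ)..x, lommelInhom β a b u) <
      lommelJ β (b - a) a b x := by
  have hb : 1 < b := by linarith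
  have h1 := lommelW_sub_add_lommelJ hβ0 (zero_le_one.trans ha.le) hb hx
  have h2 := lommelJ_sub_one_eq hβ0 (zero_le_one.trans ha.le) hb hx
  have h3 := lommelJ_add_one_lt hβ0 (zero_lt_one.trans ha) hb (by linarith) hx
  have h4 := lommelJ_le_mul_lommelW hβ0 hβ1 ha.le hb.le hab hν hK hKν hx
  have h5 : lommelW β (b - a - 1) a b x = lommelW β (b - a) a b x * (1 / x) := by
    rw [lommelW, lommelW, Real.rpow_sub_one hx.ne']; ring
  have hδ : 0 < 1 - β := sub_pos.2 hβ1
  have h6 : 4 * (b - a) * K / ((2 * (b - a) - 1) * (1 - β)) * (1 / x) * lommelW β (b - a) a b x =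
      2 * (b - a) * (K / ((b - a - 1 / 2) * (1 - β)) * lommelW β (b - a - 1) a b x) := by
    have e : 2 * (b - a) - 1 = 2 * (b - a - 1 / 2) := by ring
    have : b - a - 1 / 2 ≠ 0 := by linarith
    rw [h5, e]
    field_simp
    ring
  have h7 := mul_le_mul_of_nonneg_left h4 (by linarith : 0 ≤ 2 * (b - a))
  rw [one_div, inv_mul_lt_iff₀ hδ, sub_mul, one_mul, h6]
  linarith

/-- The strict lower bound for nonpositive `ν = b - a`. -/
theorem lommelJ_lower_bound_of_nonpos {β a b x : ℝ} (hβ0 : 0 ≤ β) (hβ1 : β < 1) (ha : 1 < a)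
    (hb : 1 < b) (hab : b ≤ a) (hx : 0 < x) :
    1 / (1 - β) * (lommelW β (b - a) a b x - ∫ u in (0 : ℝ)..x, lommelInhom β a b u) <
      lommelJ β (b - a) a b x := by
  have h1 := lommelW_sub_add_lommelJ hβ0 (zero_le_one.trans ha.le) hb hx
  have h2 := lommelJ_sub_one_lt hβ0 ha hb hab hx
  rw [one_div, inv_mul_lt_iff₀ (sub_pos.2 hβ1)]
  linarith

/-- Integration by parts makes this quotient J_{b-1}/J_b - β, and J_{b-1}/J_b inherits the limit 1
of the integrands. -/
theorem tendsto_lommelW_div_lommelJ {β a b : ℝ} (hβ0 : 0 ≤ β) (hβ1 : β < 1) (ha : 0 ≤ a)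
    (hb : 1 < b) :
    Tendsto (fun x => lommelW β (b - a) a b x / lommelJ β (b - a) a b x) atTop (𝓝 (1 - β)) := by
  have hb0 : 0 < b := zero_lt_one.trans hb
  have hb1 : 0 < b - 1 := sub_pos.2 hb
  have hW : Tendsto (fun x => lommelW β (b - a) a (b - 1) x / lommelW β (b - a) a b x)
      atTop (𝓝 1) := by
    have h := (tendsto_lommelG_ratio ha hb1).inv₀ one_ne_zero
    rw [inv_one, sub_add_cancel] at h
    refine h.congr' ?_
    filter_upwards [eventually_gt_atTop 0] with x hx
    rw [inv_div, lommelW, lommelW, mul_div_mul_left _ _ (by positivity)]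
  have hJ := tendsto_integral_div_integral
    (fun x hx => intervalIntegrable_lommelW (s := b - a) hβ0 ha hb1.le (by linarith) hx)
    (fun x hx => intervalIntegrable_lommelW (s := b - a) hβ0 ha hb0.le (by linarith) hx)
    (fun x hx => lommelW_pos β (b - a) ha hb0.le hx) hW
    (tendsto_lommelJ_atTop hβ0 hβ1 ha hb0 (by linarith))
  refine (hJ.sub_const β).congr' ?_
  filter_upwards [eventually_gt_atTop 0] with x hx
  have hpos := lommelJ_pos (s := b - a) hβ0 ha hb0.le (by linarith) hx
  rw [lommelW_sub_add_lommelJ hβ0 ha hb hx, sub_div, mul_div_cancel_right₀ _ hpos.ne']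
  rfl

theorem tendsto_integral_lommelInhom_div_lommelJ {β a b : ℝ} (hβ0 : 0 ≤ β) (hβ1 : β < 1)
    (ha : 0 ≤ a) (hb : 1 < b) :
    Tendsto (fun x => (∫ u in (0 : ℝ)..x, lommelInhom β a b u) / lommelJ β (b - a) a b x)
      atTop (𝓝 0) := by
  have hb0 : 0 < b := zero_lt_one.trans hb
  refine tendsto_integral_div_integral (fun x hx => intervalIntegrable_lommelInhom β a hb hx)
    (fun x hx => intervalIntegrable_lommelW (s := b - a) hβ0 ha hb0.le (by linarith) hx)
    (fun x hx => lommelW_pos β (b - a) ha hb0.le hx) ?_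
    (tendsto_lommelJ_atTop hβ0 hβ1 ha hb0 (by linarith))
  have h := (tendsto_rpow_div_lommelG (a + b - 3) ha hb0).const_mul
    (1 / (2 ^ (a + b - 3) * (Real.Gamma (a - 1) * Real.Gamma b)))
  rw [mul_zero] at h
  refine h.congr' ?_
  filter_upwards [eventually_gt_atTop 0] with x hx
  rw [lommelInhom, lommelW, mul_div_mul_left _ _ (by positivity), Real.div_rpow hx.le zero_le_two]
  ring

theorem tendsto_lower_bound_div_lommelJ {β a b : ℝ} (K : ℝ) (hβ0 : 0 ≤ β) (hβ1 : β < 1)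
    (ha : 0 ≤ a) (hb : 1 < b) :
    Tendsto (fun x => 1 / (1 - β) * ((1 - K * (1 / x)) * lommelW β (b - a) a b x -
      ∫ u in (0 : ℝ)..x, lommelInhom β a b u) / lommelJ β (b - a) a b x) atTop (𝓝 1) := by
  have h0 : Tendsto (fun x : ℝ => 1 - K * (1 / x)) atTop (𝓝 1) := by
    have : Tendsto (fun x : ℝ => 1 / x) atTop (𝓝 0) := tendsto_const_nhds.div_atTop tendsto_id
    simpa using (this.const_mul K).const_sub 1
  have h := ((h0.mul (tendsto_lommelW_div_lommelJ hβ0 hβ1 ha hb)).sub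
    (tendsto_integral_lommelInhom_div_lommelJ hβ0 hβ1 ha hb)).const_mul (1 / (1 - β))
  rw [one_mul, sub_zero, one_div_mul_cancel (sub_pos.2 hβ1).ne'] at h
  refine h.congr fun x => ?_
  ring

/-! ### The series bound -/

/-- Iterated integration by parts with the exponent fixed at `b - a`: at `b + k + 1` the middle
coefficient is `-(k + 1)`. The condition `b > 1/2` makes the integrals with exponent `b - a - 1`
converge at 0. -/
theorem lommelJ_eq_sum {β a b x : ℝ} (hβ : 0 ≤ β) (ha : 0 ≤ a) (hb : 1 / 2 < b) (hx : 0 < x)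
    (n : ℕ) :
    lommelJ β (b - a) a b x =
      ∑ k ∈ Finset.range n, β ^ k * lommelW β (b - a) a (b + k + 1) x +
      ∑ k ∈ Finset.range n, β ^ k * ((k + 1) * lommelJ β (b - a - 1) a (b + k + 1) x) +
      β ^ n * lommelJ β (b - a) a (b + n) x := by
  induction n with
  | zero => simp
  | succ n ih =>
    have h := lommelW_eq_lommelJ (s := b - a) (b := b + n + 1) hβ ha
      (by have := n.cast_nonneg (α := ℝ); linarith)
      (by have := n.cast_nonneg (α := ℝ); linarith) hx
    rw [add_sub_cancel_right] at h
    rw [Finset.sum_range_succ, Finset.sum_range_succ, h, ih]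
    push_cast
    rw [← add_assoc b]
    ring

/-- The `k = 0` integral is retained as a positive gap independent of `n`, which keeps the
inequality strict in the limit. -/
theorem sum_lommelW_add_le {β a b x : ℝ} (hβ : 0 ≤ β) (ha : 0 ≤ a) (hb : 1 / 2 < b) (hx : 0 < x)
    (n : ℕ) : ∑ k ∈ Finset.range n, β ^ k * lommelW β (b - a) a (b + k + 1) x +
      lommelJ β (b - a - 1) a (b + 1) x ≤ lommelJ β (b - a) a b x := by
  have hk : ∀ k : ℕ, 0 ≤ b + k := fun k => by positivity
  have hJ : ∀ k : ℕ, 0 < lommelJ β (b - a - 1) a (b + k + 1) x := fun k =>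
    lommelJ_pos hβ ha (by linarith [hk k]) (by linarith [k.cast_nonneg (α := ℝ)]) hx
  -- One step beyond `n`, so that the `k = 0` integral occurs even for `n = 0`.
  have h1 := lommelJ_eq_sum hβ ha hb hx (n + 1)
  have h2 : 0 < lommelJ β (b - a) a (b + (n + 1 : ℕ)) x :=
    lommelJ_pos hβ ha (hk _) (by linarith [(n + 1).cast_nonneg (α := ℝ)]) hx
  have h3 : lommelJ β (b - a - 1) a (b + 1) x ≤ ∑ k ∈ Finset.range (n + 1),
      β ^ k * ((k + 1) * lommelJ β (b - a - 1) a (b + k + 1) x) := by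
    refine le_trans (le_of_eq (by simp)) (Finset.single_le_sum
      (f := fun k : ℕ => β ^ k * (((k : ℝ) + 1) * lommelJ β (b - a - 1) a (b + k + 1) x))
      (fun k _ => ?_) (Finset.mem_range.2 n.succ_pos))
    have := hJ k
    positivity
  have h4 : 0 ≤ β ^ n * lommelW β (b - a) a (b + n + 1) x :=
    mul_nonneg (by positivity) (lommelW_pos _ _ ha (by linarith [hk n]) hx).le
  have h5 : 0 ≤ β ^ (n + 1) * lommelJ β (b - a) a (b + (n + 1 : ℕ)) x := by positivity
  rw [Finset.sum_range_succ] at h1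
  linarith

theorem summable_lommelW {β a b x : ℝ} (hβ : 0 ≤ β) (ha : 0 ≤ a) (hb : 1 / 2 < b) (hx : 0 < x) :
    Summable (fun k : ℕ => β ^ k * lommelW β (b - a) a (b + k + 1) x) :=
  summable_of_sum_range_le (c := lommelJ β (b - a) a b x)
    (fun k => mul_nonneg (by positivity) (lommelW_pos _ _ ha (by positivity) hx).le)
    (fun n => by
      have h1 := sum_lommelW_add_le hβ ha hb hx n
      have h2 := lommelJ_pos (s := b - a - 1) (b := b + 1) hβ ha (by linarith) (by linarith) hx
      linarith)

theorem tsum_lommelW_lt {β a b x : ℝ} (hβ : 0 ≤ β) (ha : 0 ≤ a) (hb : 1 / 2 < b) (hx : 0 < x) :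
    ∑' k : ℕ, β ^ k * lommelW β (b - a) a (b + k + 1) x < lommelJ β (b - a) a b x := by
  have h1 := (summable_lommelW hβ ha hb hx).tsum_le_of_sum_range_le
    (c := lommelJ β (b - a) a b x - lommelJ β (b - a - 1) a (b + 1) x)
    (fun n => by linarith [sum_lommelW_add_le hβ ha hb hx n])
  have h2 := lommelJ_pos (s := b - a - 1) (b := b + 1) hβ ha (by linarith) (by linarith) hx
  linarith

theorem tendsto_lommelJ_div_lommelJ_zero {β a b : ℝ} (hβ0 : 0 ≤ β) (hβ1 : β < 1) (ha : 0 ≤ a)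
    (hb : 1 / 2 < b) (k : ℕ) :
    Tendsto (fun x => lommelJ β (b - a - 1) a (b + k + 1) x / lommelJ β (b - a) a b x)
      atTop (𝓝 0) := by
  have hb0 : 0 < b := by linarith
  obtain ⟨C, hC, hCle⟩ := exists_forall_lommelG_add_natCast_le ha hb0
  refine tendsto_integral_div_integral
    (fun x hx => intervalIntegrable_lommelW (s := b - a - 1) (b := b + k + 1) hβ0 ha
      (by positivity) (by linarith [k.cast_nonneg (α := ℝ)]) hx)
    (fun x hx => intervalIntegrable_lommelW (s := b - a) hβ0 ha hb0.le (by linarith) hx)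
    (fun x hx => lommelW_pos β (b - a) ha hb0.le hx) ?_
    (tendsto_lommelJ_atTop hβ0 hβ1 ha hb0 (by linarith))
  have h0 : Tendsto (fun x : ℝ => C / x) atTop (𝓝 0) := tendsto_const_nhds.div_atTop tendsto_id
  refine tendsto_of_tendsto_of_tendsto_of_le_of_le' tendsto_const_nhds h0 ?_ ?_
  · filter_upwards [eventually_gt_atTop 0] with x hx
    exact div_nonneg (lommelW_pos _ _ ha (by positivity) hx).le (lommelW_pos _ _ ha hb0.le hx).le
  · filter_upwards [eventually_gt_atTop 0] with x hx
    have h := hCle (k + 1) x hx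
    push_cast at h
    rw [← add_assoc] at h
    rw [div_le_div_iff₀ (lommelW_pos _ _ ha hb0.le hx) hx, lommelW, lommelW,
      Real.rpow_sub_one hx.ne']
    calc Real.exp (-(β * x)) * (x ^ (b - a) / x) * lommelG a (b + k + 1) x * x
        = Real.exp (-(β * x)) * x ^ (b - a) * lommelG a (b + k + 1) x := by field_simp
      _ ≤ Real.exp (-(β * x)) * x ^ (b - a) * (C * lommelG a b x) := by gcongr
      _ = _ := by ring

/-- For fixed `n` the deficit is at most the `n` integrals with exponent lowered by one, negligible
against J_b, plus β^n J_{b+n} ≤ C β^n J_b with `C` independent of `n`. So `n` is chosen before `x`.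
-/
theorem tendsto_tsum_lommelW_div_lommelJ {β a b : ℝ} (hβ0 : 0 ≤ β) (hβ1 : β < 1) (ha : 0 ≤ a)
    (hb : 1 / 2 < b) :
    Tendsto (fun x => (∑' k : ℕ, β ^ k * lommelW β (b - a) a (b + k + 1) x) /
      lommelJ β (b - a) a b x) atTop (𝓝 1) := by
  have hb0 : 0 < b := by linarith
  obtain ⟨C, hC, hCle⟩ := exists_forall_lommelG_add_natCast_le ha hb0
  rw [Metric.tendsto_nhds]
  intro ε hε
  have hpow : Tendsto (fun n : ℕ => C * β ^ n) atTop (𝓝 0) := by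
    simpa using (tendsto_pow_atTop_nhds_zero_of_lt_one hβ0 hβ1).const_mul C
  obtain ⟨n, hn⟩ := (hpow.eventually (gt_mem_nhds (half_pos hε))).exists
  have hsum : Tendsto (fun x => ∑ k ∈ Finset.range n, β ^ k * (((k : ℝ) + 1) *
      (lommelJ β (b - a - 1) a (b + k + 1) x / lommelJ β (b - a) a b x))) atTop (𝓝 0) := by
    have := tendsto_finsetSum (Finset.range n) (fun k _ =>
      ((tendsto_lommelJ_div_lommelJ_zero hβ0 hβ1 ha hb k).const_mul ((k : ℝ) + 1)).const_mul (β ^ k))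
    simpa using this
  filter_upwards [hsum.eventually (gt_mem_nhds (half_pos hε)), eventually_gt_atTop 0] with x h1 hx
  have hJ : 0 < lommelJ β (b - a) a b x := lommelJ_pos hβ0 ha hb0.le (by linarith) hx
  have h2 := tsum_lommelW_lt hβ0 ha hb hx
  have h3 := (summable_lommelW hβ0 ha hb hx).sum_le_tsum (Finset.range n)
    (fun k _ => mul_nonneg (by positivity) (lommelW_pos _ _ ha (by positivity) hx).le)
  have h4 := lommelJ_eq_sum hβ0 ha hb hx n
  have h5 : lommelJ β (b - a) a (b + n) x ≤ C * lommelJ β (b - a) a b x := by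
    rw [lommelJ, lommelJ, ← intervalIntegral.integral_const_mul]
    refine intervalIntegral.integral_mono_on_of_le_Ioo hx.le
      (intervalIntegrable_lommelW hβ0 ha (by positivity) (by linarith [n.cast_nonneg (α := ℝ)]) hx)
      ((intervalIntegrable_lommelW hβ0 ha hb0.le (by linarith) hx).const_mul C) (fun u hu => ?_)
    have hu0 : 0 < u := hu.1
    rw [lommelW, lommelW, mul_left_comm C]
    gcongr
    exact hCle n u hu0
  have h6 : ∑ k ∈ Finset.range n, β ^ k * ((k + 1) * lommelJ β (b - a - 1) a (b + k + 1) x) <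
      ε / 2 * lommelJ β (b - a) a b x := by
    rw [← div_lt_iff₀ hJ, Finset.sum_div]
    refine lt_of_eq_of_lt (Finset.sum_congr rfl fun k _ => ?_) h1
    ring
  have h7 : β ^ n * lommelJ β (b - a) a (b + n) x ≤ ε / 2 * lommelJ β (b - a) a b x := by
    calc β ^ n * lommelJ β (b - a) a (b + n) x ≤ β ^ n * (C * lommelJ β (b - a) a b x) := by gcongr
      _ = C * β ^ n * lommelJ β (b - a) a b x := by ring
      _ ≤ _ := by gcongr
  rw [Real.dist_eq, div_sub_one hJ.ne', abs_div, abs_of_pos hJ, div_lt_iff₀ hJ, abs_lt]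
  constructor <;> nlinarith

/-! ### Return to the parameters `μ`, `ν` -/

theorem lommelIntegral_eq_lommelJ (μ ν β x : ℝ) :
    lommelIntegral μ ν β x = lommelJ β ν ((μ - ν + 3) / 2) ((μ + ν + 3) / 2) x := by
  rw [lommelIntegral, lommelJ]
  simp only [lommelW, lommelT_eq_lommelG]

theorem isTightStrictLowerBound_congr {L L' F : ℝ → ℝ} (h : ∀ x, 0 < x → L x = L' x)
    (hL : IsTightStrictLowerBound L' F) : IsTightStrictLowerBound L F :=
  ⟨fun x hx => (h x hx).trans_lt (hL.1 x hx), hL.2.congr' (by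
    filter_upwards [eventually_gt_atTop 0] with x hx
    rw [h x hx])⟩

theorem isTightStrictLowerBound_of_half_lt {μ ν β K : ℝ} (hβ0 : 0 < β) (hβ1 : β < 1)
    (hν : 1 / 2 < ν) (hνμ : ν < μ + 1) (hK : 1 ≤ K) (hKν : ν - 1 / 2 ≤ K) :
    IsTightStrictLowerBound
      (fun x => 1 / (1 - β) *
        ((1 - 4 * ν * K / ((2 * ν - 1) * (1 - β)) * (1 / x)) *
          (Real.exp (-(β * x)) * x ^ ν * lommelT μ ν x) - lommelB μ ν β x))
      (lommelIntegral μ ν β) := by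
  have hba : (μ + ν + 3) / 2 - (μ - ν + 3) / 2 = ν := by ring
  have h1 := fun x hx => lommelJ_lower_bound (a := (μ - ν + 3) / 2) (b := (μ + ν + 3) / 2)
    (K := K) (x := x) hβ0.le hβ1 (by linarith) (by linarith) (by linarith) hK (by linarith) hx
  have h2 := tendsto_lower_bound_div_lommelJ (a := (μ - ν + 3) / 2) (b := (μ + ν + 3) / 2)
    (4 * ν * K / ((2 * ν - 1) * (1 - β))) hβ0.le hβ1 (by linarith) (by linarith)
  rw [hba] at h1 h2
  rw [show lommelIntegral μ ν β = _ from funext (lommelIntegral_eq_lommelJ μ ν β)]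
  refine isTightStrictLowerBound_congr (fun x hx => ?_) ⟨h1, h2⟩
  rw [lommelB_eq_integral _ _ _ hβ0 hx, lommelT_eq_lommelG, lommelW]

theorem isTightStrictLowerBound_of_nonpos {μ ν β : ℝ} (hβ0 : 0 < β) (hβ1 : β < 1)
    (hμν : -μ - 1 < ν) (hν : ν ≤ 0) :
    IsTightStrictLowerBound
      (fun x => 1 / (1 - β) *
        (Real.exp (-(β * x)) * x ^ ν * lommelT μ ν x - lommelB μ ν β x))
      (lommelIntegral μ ν β) := by
  have hba : (μ + ν + 3) / 2 - (μ - ν + 3) / 2 = ν := by ring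
  have h1 := fun x hx => lommelJ_lower_bound_of_nonpos (a := (μ - ν + 3) / 2)
    (b := (μ + ν + 3) / 2) (x := x) hβ0.le hβ1 (by linarith) (by linarith) (by linarith) hx
  have h2 := tendsto_lower_bound_div_lommelJ (a := (μ - ν + 3) / 2) (b := (μ + ν + 3) / 2)
    0 hβ0.le hβ1 (by linarith) (by linarith)
  simp only [zero_mul, sub_zero, one_mul] at h2
  rw [hba] at h1 h2
  rw [show lommelIntegral μ ν β = _ from funext (lommelIntegral_eq_lommelJ μ ν β)]
  refine isTightStrictLowerBound_congr (fun x hx => ?_) ⟨h1, h2⟩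
  rw [lommelB_eq_integral _ _ _ hβ0 hx, lommelT_eq_lommelG, lommelW]

theorem pow_mul_lommelW_eq (μ ν β x : ℝ) (k : ℕ) :
    β ^ k * lommelW β ν ((μ - ν + 3) / 2) ((μ + ν + 3) / 2 + k + 1) x =
      Real.exp (-(β * x)) * x ^ ν * (β ^ k * lommelT (μ + k + 1) (ν + k + 1) x) := by
  rw [lommelW, lommelT_eq_lommelG,
    show (μ + k + 1 - (ν + k + 1) + 3) / 2 = (μ - ν + 3) / 2 by ring,
    show (μ + k + 1 + (ν + k + 1) + 3) / 2 = (μ + ν + 3) / 2 + k + 1 by ring]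
  ring

end

theorem mainTheorem2 (μ ν β : ℝ) (hβ0 : 0 < β) (hβ1 : β < 1) :
    -- first bound
    (-1 < μ → -μ - 1 < ν → ν ≤ 0 →
      IsTightStrictLowerBound
        (fun x => 1 / (1 - β) *
          (Real.exp (-(β * x)) * x ^ ν * lommelT μ ν x - lommelB μ ν β x))
        (lommelIntegral μ ν β)) ∧
    -- second bound
    (1 / 2 < μ → 3 / 2 ≤ ν → ν < μ + 1 →
      IsTightStrictLowerBound
        (fun x => 1 / (1 - β) *
          ((1 - 4 * ν ^ 2 / ((2 * ν - 1) * (1 - β)) * (1 / x)) *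
            (Real.exp (-(β * x)) * x ^ ν * lommelT μ ν x) - lommelB μ ν β x))
        (lommelIntegral μ ν β)) ∧
    -- third bound
    (-1 / 2 < μ → 1 / 2 < ν → ν < μ + 1 →
      IsTightStrictLowerBound
        (fun x => 1 / (1 - β) *
          ((1 - 2 * ν * (μ + ν + 1 / 2 * (5 + Real.sqrt 17)) / ((2 * ν - 1) * (1 - β)) * (1 / x)) *
            (Real.exp (-(β * x)) * x ^ ν * lommelT μ ν x) - lommelB μ ν β x))
        (lommelIntegral μ ν β)) ∧
    -- fourth bound; its parameter range contains the other three
    (-5 / 2 < μ → -μ - 2 < ν → ν ≤ μ + 3 →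
      (∀ x : ℝ, 0 < x →
        IntervalIntegrable (fun u => Real.exp (-(β * u)) * u ^ ν * lommelT μ ν u)
          MeasureTheory.volume 0 x ∧
        Summable (fun k : ℕ => β ^ k * lommelT (μ + k + 1) (ν + k + 1) x)) ∧
      IsTightStrictLowerBound
        (fun x => Real.exp (-(β * x)) * x ^ ν *
          ∑' k : ℕ, β ^ k * lommelT (μ + k + 1) (ν + k + 1) x)
        (lommelIntegral μ ν β)) := by
  refine ⟨fun _ => isTightStrictLowerBound_of_nonpos hβ0 hβ1, fun _ hν hνμ => ?_, fun hμ hν hνμ => ?_,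
    fun hμ hμν hν => ?_⟩
  -- Any `K ≥ max 1 (ν - 1/2)` is admissible; `K = ν` produces the stated coefficient.
  · have h := isTightStrictLowerBound_of_half_lt (K := ν) hβ0 hβ1 (by linarith) hνμ
      (by linarith) (by linarith)
    rwa [show 4 * ν * ν = 4 * ν ^ 2 by ring] at h
  -- Only `√17 ≥ 0` matters: with `ν < μ + 1` the chosen `K` already exceeds both 1 and `ν - 1/2`.
  · have hs := Real.sqrt_nonneg 17
    have h := isTightStrictLowerBound_of_half_lt (K := (μ + ν + 1 / 2 * (5 + Real.sqrt 17)) / 2)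
      hβ0 hβ1 hν hνμ (by linarith) (by linarith)
    rwa [show 4 * ν * ((μ + ν + 1 / 2 * (5 + Real.sqrt 17)) / 2) =
      2 * ν * (μ + ν + 1 / 2 * (5 + Real.sqrt 17)) by ring] at h
  · have ha : 0 ≤ (μ - ν + 3) / 2 := by linarith
    have hb : 1 / 2 < (μ + ν + 3) / 2 := by linarith
    have hba : (μ + ν + 3) / 2 - (μ - ν + 3) / 2 = ν := by ring
    have h1 := fun x hx => tsum_lommelW_lt (x := x) hβ0.le ha hb hx
    have h2 := tendsto_tsum_lommelW_div_lommelJ hβ0.le hβ1 ha hb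
    rw [hba] at h1 h2
    refine ⟨fun x hx => ⟨?_, ?_⟩, ?_⟩
    · have h := intervalIntegrable_lommelW (s := ν) (b := (μ + ν + 3) / 2) hβ0.le ha (by linarith)
        (by linarith) hx
      simp only [lommelT_eq_lommelG]
      exact h
    · have h := summable_lommelW hβ0.le ha hb hx
      rw [hba] at h
      simp only [pow_mul_lommelW_eq] at h
      exact (summable_mul_left_iff (by positivity)).1 h
    · rw [show lommelIntegral μ ν β = _ from funext (lommelIntegral_eq_lommelJ μ ν β)]
      refine isTightStrictLowerBound_congr (fun x _ => ?_) ⟨h1, h2⟩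
      simp only [pow_mul_lommelW_eq, tsum_mul_left]
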